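/- Let $n\ge 1$. A variable exponent is a measurable $p:\mathbb R^n\to[1,\infty]$; put $p^+=\operatorname{ess\,sup}_{\mathbb R^n}p$. Write $p\in\mathcal P^{\log}(\mathbb R^n)$ if $g=1/p$ is log-Hölder continuous, i.e. there are $c\ge0$ and $g_\infty\in\mathbb R$ with $$|g(x)-g(y)|\le \frac{c}{\log(e+1/|x-y|)}\ \ (x\ne y),\qquad |g(x)-g_\infty|\le\frac{c}{\log(e+|x|)}\ \ (x\in\mathbb R^n),$$ and let $c_{\log}(p)$ be the smallest such $c$. Let $\varphi(x,t)=t^{p(x)}$ and, for $a\ge0$ and $t\ge 0$, $$\varphi_a(x,t)=\int_0^t\frac{\varphi'(x,a+\tau)}{a+\tau}\,\tau\,d\tau,$$ where $'$ denotes the derivative in the second variable. Let $Q$ stand for an open cube (of any orientation), with side length $\ell(Q)$, or an open ball, with $\ell(Q)$ its diameter. The space $(W^{1,p(\cdot)}(Q))^n$ consists of the $u:Q\to\mathbb R^n$ whose components and their weak first partial derivatives lie in $L^{p(\cdot)}(Q)$, i.e. are measurable functions $f$ with $\int_Q|f(x)/\lambda|^{p(x)}dx\le1$ for some $\lambda>0$.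 For such $u$ let $Du=\frac12(\nabla u+\nabla u^{T})$ be the symmetric part of its weak gradient, $|Du|$ its Euclidean (Frobenius) norm. A rigid motion is a map $x\mapsto Ax+b$ with $A\in\mathbb R^{n\times n}$, $A^T+A=0$, $b\in\mathbb R^n$. **Theorem (shifted Korn inequality).** To each $Q$ and each $u$ one can assign a rigid motion $\mathcal R_Qu$, depending only on $Q$ and $u$, such that the following holds. For all $m>0$, $K\ge0$ and $P\ge 0$ there is a constant $c>0$, depending only on $n,m,K,P$, such that $$\int_Q\varphi_a\Big(x,\frac{|u(x)-\mathcal R_Qu(x)|}{\ell(Q)}\Big)dx\le c\int_Q\varphi_a(x,|Du(x)|)\,dx+c\,|Q|^m$$ for every $p\in\mathcal P^{\log}(\mathbb R^n)$ with $c_{\log}(p)\le K$ and $p^+\le P<\infty$, every cube or ball $Q\subset\mathbb R^n$ with $\ell(Q)\le1$, every $u\in (W^{1,p(\cdot)}(Q))^n$ and every $a\ge0$ with $$a+\frac1{|Q|}\int_Q|Du|\,dy\le |Q|^{-m}.$$ -/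

import Mathlib

open MeasureTheory
open scoped NNReal ENNReal

noncomputable section

namespace ShiftedKorn

/-! ### Variable exponents -/

/-- The class of variable exponents: measurable functions `p : ℝⁿ → [1, ∞]`. -/
def IsVariableExponent {n : ℕ} (p : EuclideanSpace ℝ (Fin n) → ℝ≥0∞) : Prop :=
  Measurable p ∧ ∀ x, 1 ≤ p x

/-- `p⁺`, the essential supremum of `p` over `ℝⁿ`. -/
def pPlus {n : ℕ} (p : EuclideanSpace ℝ (Fin n) → ℝ≥0∞) : ℝ≥0∞ :=
  essSup p volume

/-- `g` satisfies the local log-Hölder condition and the log-Hölder decay condition with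
the constant `c`. -/
def IsLogHolderWith {n : ℕ} (c : ℝ) (g : EuclideanSpace ℝ (Fin n) → ℝ) : Prop :=
  0 ≤ c ∧
    (∀ x y, x ≠ y → |g x - g y| ≤ c / Real.log (Real.exp 1 + 1 / ‖x - y‖)) ∧
    ∃ gInf : ℝ, ∀ x, |g x - gInf| ≤ c / Real.log (Real.exp 1 + ‖x‖)

/-- The function `1/p : ℝⁿ → [0, 1]`, with `1/∞ = 0`. -/
def recip {n : ℕ} (p : EuclideanSpace ℝ (Fin n) → ℝ≥0∞) (x : EuclideanSpace ℝ (Fin n)) : ℝ :=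
  ((p x)⁻¹).toReal

/-- The class of variable exponents `p` for which `1/p` is log-Hölder continuous. -/
def IsLogHolderExponent {n : ℕ} (p : EuclideanSpace ℝ (Fin n) → ℝ≥0∞) : Prop :=
  IsVariableExponent p ∧ ∃ c, IsLogHolderWith c (recip p)

/-- `c_log(p)`, the smallest log-Hölder constant of `1/p`. -/
def cLog {n : ℕ} (p : EuclideanSpace ℝ (Fin n) → ℝ≥0∞) : ℝ :=
  sInf {c | IsLogHolderWith c (recip p)}

/-- `φ(x, t) = t ^ p(x)`, for exponents that are finite (as those with `p⁺ < ∞` and `1/p`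
continuous are at every point). -/
def phi {n : ℕ} (p : EuclideanSpace ℝ (Fin n) → ℝ≥0∞) (x : EuclideanSpace ℝ (Fin n))
    (t : ℝ) : ℝ :=
  t ^ (p x).toReal

/-- The shifted function `φ_a(x, t) = ∫₀ᵗ φ'(x, a + τ) / (a + τ) * τ dτ`, where `'` is the
derivative in the second variable. -/
def phiShift {n : ℕ} (p : EuclideanSpace ℝ (Fin n) → ℝ≥0∞) (a : ℝ)
    (x : EuclideanSpace ℝ (Fin n)) (t : ℝ) : ℝ :=
  ∫ τ in (0 : ℝ)..t, deriv (phi p x) (a + τ) / (a + τ) * τ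

/-! ### Variable exponent Lebesgue and Sobolev spaces -/

/-- The Luxemburg norm of `f` in `L^{p(·)}(Ω)`; it is `∞` if no `s` is admissible. -/
def luxemburgNorm {n : ℕ} (p : EuclideanSpace ℝ (Fin n) → ℝ≥0∞)
    (Ω : Set (EuclideanSpace ℝ (Fin n))) (f : EuclideanSpace ℝ (Fin n) → ℝ) : ℝ≥0∞ :=
  ⨅ (s : ℝ) (_ : 0 < s) (_ : (∫⁻ x in Ω, ENNReal.ofReal (phi p x |f x / s|)) ≤ 1),
    ENNReal.ofReal s

/-- `f ∈ L^{p(·)}(Ω)`. -/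
def MemVarLp {n : ℕ} (p : EuclideanSpace ℝ (Fin n) → ℝ≥0∞)
    (Ω : Set (EuclideanSpace ℝ (Fin n))) (f : EuclideanSpace ℝ (Fin n) → ℝ) : Prop :=
  AEMeasurable f (volume.restrict Ω) ∧ luxemburgNorm p Ω f < ∞

/-- `g` is the weak partial derivative `∂_j f` on the open set `Ω`. -/
def IsWeakPartialDeriv {n : ℕ} (Ω : Set (EuclideanSpace ℝ (Fin n))) (j : Fin n)
    (f g : EuclideanSpace ℝ (Fin n) → ℝ) : Prop :=
  LocallyIntegrableOn f Ω volume ∧ LocallyIntegrableOn g Ω volume ∧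
    ∀ ψ : EuclideanSpace ℝ (Fin n) → ℝ, ContDiff ℝ (⊤ : ℕ∞) ψ → HasCompactSupport ψ →
      tsupport ψ ⊆ Ω →
      (∫ x in Ω, f x * fderiv ℝ ψ x (EuclideanSpace.single j 1)) = -(∫ x in Ω, g x * ψ x)

/-- `u ∈ (W^{1,p(·)}(Ω))ⁿ` with weak gradient `G`, where `G x i j = ∂_j u_i (x)`. -/
def MemVarSobolev {n : ℕ} (p : EuclideanSpace ℝ (Fin n) → ℝ≥0∞)
    (Ω : Set (EuclideanSpace ℝ (Fin n)))
    (u : EuclideanSpace ℝ (Fin n) → EuclideanSpace ℝ (Fin n))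
    (G : EuclideanSpace ℝ (Fin n) → Matrix (Fin n) (Fin n) ℝ) : Prop :=
  ∀ i, MemVarLp p Ω (fun x => u x i) ∧
    ∀ j, IsWeakPartialDeriv Ω j (fun x => u x i) (fun x => G x i j) ∧
      MemVarLp p Ω (fun x => G x i j)

/-! ### Symmetric gradients, rigid motions, cubes and balls -/

/-- The Euclidean (Frobenius) norm of a matrix. -/
def matNorm {n : ℕ} (A : Matrix (Fin n) (Fin n) ℝ) : ℝ :=
  Real.sqrt (∑ i, ∑ j, A i j ^ 2)

/-- The symmetric part of a matrix; `D u = symPart (∇ u)`. -/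
def symPart {n : ℕ} (A : Matrix (Fin n) (Fin n) ℝ) : Matrix (Fin n) (Fin n) ℝ :=
  (1 / 2 : ℝ) • (A + A.transpose)

/-- (Linearised) rigid motions: `x ↦ A x + b` with `Aᵀ + A = 0`. -/
def IsRigidMotion {n : ℕ} (R : EuclideanSpace ℝ (Fin n) → EuclideanSpace ℝ (Fin n)) : Prop :=
  ∃ (A : Matrix (Fin n) (Fin n) ℝ) (b : EuclideanSpace ℝ (Fin n)),
    A.transpose + A = 0 ∧ ∀ x, R x = WithLp.toLp 2 (A.mulVec x.ofLp) + b

/-- The open cube with centre `z`, edges parallel to the orthonormal basis `e`, and side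
length `l`. -/
def openCube {n : ℕ} (z : EuclideanSpace ℝ (Fin n))
    (e : OrthonormalBasis (Fin n) ℝ (EuclideanSpace ℝ (Fin n))) (l : ℝ) :
    Set (EuclideanSpace ℝ (Fin n)) :=
  {x | ∀ i, |inner ℝ (e i) (x - z)| < l / 2}

/-- `Q` is an open cube of side length `l > 0` or an open ball of diameter `l > 0`. -/
def IsCubeOrBall {n : ℕ} (Q : Set (EuclideanSpace ℝ (Fin n))) (l : ℝ) : Prop :=
  0 < l ∧ ((∃ z e, Q = openCube z e l) ∨ ∃ z, Q = Metric.ball z (l / 2))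

end ShiftedKorn

end

open ShiftedKorn

/-! The proof has two halves: a pointwise bound of `u - 𝓡 Q u` by averages of `Du`, and a
Jensen-type inequality for the shifted modular that survives a variable exponent.

Pointwise bound. For smooth `u` and a weight `η` of unit mass supported in `Q`, take the average
over `y`, with weight `η`, of the rigid motions `x ↦ u(y) + (skew part of ∇u(y)) (x - y)`.
Integration by parts moves all derivatives onto `η`, so the formula makes sense for integrable `u`
and involves neither `p` nor the weak gradient. Written around `x`, the result is `∑ l, ∫ u_l`
against a kernel (`motionKernel`). Dilating the kernel towards `x` by `s ∈ (0,1]` interpolates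
between the rigid motion at `s = 1` and, at Lebesgue points, `u(x)` as `s → 0`. The derivative in
`s` is a divergence: `divRadial_motionKernel` writes the radial divergence of the kernel as the
divergence of `strainKernel`, which is symmetric in its last two indices, so one integration by
parts leaves only `Du`. Integrating in `s` gives `|u - 𝓡 Q u|(x) ≤ C ℓ(Q) ∫₀¹ ⨍_Q |Du|(x + s(y - x))
dy ds` (`exists_rigidMotion_pointwise`).

Modular. `φ_a(x, t)` is comparable to `(a + t)^(p(x) - 2) t²`. At a fixed exponent, monotonicity of
the quotient by `t` replaces convexity. On the copy of `Q` shrunk by `s` towards `x`, of diameter at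
most `d = 2 n s ℓ(Q)`, the exponent oscillates by at most a constant over `log (e + 1/d)`, while the
relevant values are at most a power of `e + 1/d`: the average of `|Du|` over the copy is at most
`s^(-n)` times that over `Q`, hence controlled by `s^(-n) |Q|^(-m)`. Changing the exponent therefore
costs a bounded factor; values below the threshold `|Q|^m` go into the error term
(`shiftPow_average_le`, `exists_average_estimate`). A second use of the Jensen substitute, in `s`,
and Fubini with a change of variables of Jacobian at most `2^n` finish the proof
(`exists_modular_estimate`). -/

namespace ShiftedKorn

open Filter Topology

/-! ### The shifted power and its explicit equivalent -/

/-- The nondecreasing factor in `shiftPow a q t = shiftSlope a q t * t`. -/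
noncomputable def shiftSlope (a q t : ℝ) : ℝ := (a + t) ^ (q - 1) * (t / (a + t))

/-- The explicit function `(a + t) ^ (q - 2) * t ^ 2`, equivalent to the shift of `t ^ q`. -/
noncomputable def shiftPow (a q t : ℝ) : ℝ := shiftSlope a q t * t

lemma shiftSlope_nonneg {a q t : ℝ} (ha : 0 ≤ a) (ht : 0 ≤ t) : 0 ≤ shiftSlope a q t := by
  unfold shiftSlope; positivity

lemma shiftPow_nonneg {a q t : ℝ} (ha : 0 ≤ a) (ht : 0 ≤ t) : 0 ≤ shiftPow a q t :=
  mul_nonneg (shiftSlope_nonneg ha ht) ht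

lemma shiftSlope_mono {a q s t : ℝ} (ha : 0 ≤ a) (hq : 1 ≤ q) (hs : 0 ≤ s) (hst : s ≤ t) :
    shiftSlope a q s ≤ shiftSlope a q t := by
  rcases hs.eq_or_lt with rfl | hs
  · simpa [shiftSlope] using shiftSlope_nonneg (q := q) ha hst
  · have ht := hs.trans_le hst
    have h1 : (a + s) ^ (q - 1) ≤ (a + t) ^ (q - 1) :=
      Real.rpow_le_rpow (by positivity) (by linarith) (by linarith)
    have h2 : s / (a + s) ≤ t / (a + t) := by
      rw [div_le_div_iff₀ (by positivity) (by positivity)]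
      nlinarith
    exact mul_le_mul h1 h2 (by positivity) (by positivity)

/-- For `c ≥ 1` one has `a + t ≤ a + c t ≤ c (a + t)`; the constant does not depend on the shift
`a`. -/
lemma shiftSlope_mul_le {a q t c : ℝ} (ha : 0 ≤ a) (hq : 1 ≤ q) (ht : 0 ≤ t) (hc : 1 ≤ c) :
    shiftSlope a q (c * t) ≤ c ^ q * shiftSlope a q t := by
  rcases ht.eq_or_lt with rfl | ht
  · simp [shiftSlope]
  have hc0 : 0 < c := by linarith
  have h1 : (a + c * t) ^ (q - 1) ≤ c ^ (q - 1) * (a + t) ^ (q - 1) := by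
    rw [← Real.mul_rpow (by positivity) (by positivity)]
    exact Real.rpow_le_rpow (by positivity) (by nlinarith) (by linarith)
  have h2 : c * t / (a + c * t) ≤ c * (t / (a + t)) := by
    rw [mul_div_assoc]
    gcongr
    nlinarith
  calc shiftSlope a q (c * t) ≤ (c ^ (q - 1) * (a + t) ^ (q - 1)) * (c * (t / (a + t))) :=
        mul_le_mul h1 h2 (by positivity) (by positivity)
    _ = (c ^ (q - 1) * c) * shiftSlope a q t := by unfold shiftSlope; ring
    _ = c ^ q * shiftSlope a q t := by
        rw [← Real.rpow_add_one hc0.ne']; simp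

lemma shiftPow_mul_le {a q t c : ℝ} (ha : 0 ≤ a) (hq : 1 ≤ q) (ht : 0 ≤ t) (hc : 1 ≤ c) :
    shiftPow a q (c * t) ≤ c ^ (q + 1) * shiftPow a q t := by
  have h := shiftSlope_mul_le ha hq ht hc
  have hc0 : 0 < c := by linarith
  rw [Real.rpow_add_one hc0.ne']
  unfold shiftPow
  nlinarith [mul_le_mul_of_nonneg_right h (mul_nonneg hc0.le ht)]

lemma shiftPow_le_rpow {a q t : ℝ} (ha : 0 ≤ a) (ht : 0 ≤ t) :
    shiftPow a q t ≤ (a + t) ^ q := by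
  rcases ht.eq_or_lt with rfl | ht
  · simp only [shiftPow, mul_zero]; positivity
  have h0 : 0 < a + t := by linarith
  have h1 : t / (a + t) ≤ 1 := by rw [div_le_one h0]; linarith
  have h2 : (a + t) ^ q = (a + t) ^ (q - 1) * (a + t) := by
    rw [← Real.rpow_add_one h0.ne']; simp
  rw [h2]
  unfold shiftPow shiftSlope
  have h3 : 0 ≤ (a + t) ^ (q - 1) := by positivity
  have : (a + t) ^ (q - 1) * (t / (a + t)) ≤ (a + t) ^ (q - 1) * 1 :=
    mul_le_mul_of_nonneg_left h1 h3
  nlinarith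

/-- Changing the exponent costs a power of `a + t`. -/
lemma shiftPow_eq_rpow_mul {a q r t : ℝ} (ha : 0 ≤ a) (ht : 0 < t) :
    shiftPow a r t = (a + t) ^ (r - q) * shiftPow a q t := by
  have h0 : 0 < a + t := by linarith
  have : (a + t) ^ (r - 1) = (a + t) ^ (r - q) * (a + t) ^ (q - 1) := by
    rw [← Real.rpow_add h0]; congr 1; ring
  unfold shiftPow shiftSlope
  rw [this]; ring

variable {n : ℕ}

/-- Only `τ = 0` needs care, since for `a = 0` the derivative and the quotient take default values
there; the factor `τ` makes both integrands vanish. -/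
lemma phiShift_eq {p : EuclideanSpace ℝ (Fin n) → ℝ≥0∞} {a t : ℝ} {x : EuclideanSpace ℝ (Fin n)}
    (ha : 0 ≤ a) (ht : 0 ≤ t) :
    phiShift p a x t =
      ∫ τ in (0 : ℝ)..t, (p x).toReal * shiftSlope a (p x).toReal τ := by
  unfold phiShift
  refine intervalIntegral.integral_congr fun τ hτ => ?_
  rw [Set.uIcc_of_le ht] at hτ
  rcases hτ.1.eq_or_lt with h0 | h0
  · simp [← h0, shiftSlope]
  · have h : 0 < a + τ := by linarith
    have hd : deriv (phi p x) (a + τ) = (p x).toReal * (a + τ) ^ ((p x).toReal - 1) :=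
      (Real.hasDerivAt_rpow_const (p := (p x).toReal) (Or.inl h.ne')).deriv
    simp only [hd, shiftSlope]
    ring

lemma intervalIntegrable_shiftSlope {a q s t : ℝ} (ha : 0 ≤ a) (hq : 1 ≤ q) (hs : 0 ≤ s)
    (ht : 0 ≤ t) : IntervalIntegrable (shiftSlope a q) volume s t := by
  apply MonotoneOn.intervalIntegrable
  intro u hu v hv huv
  exact shiftSlope_mono ha hq ((le_min hs ht).trans hu.1) huv

lemma phiShift_le {p : EuclideanSpace ℝ (Fin n) → ℝ≥0∞} {a t P : ℝ} {x : EuclideanSpace ℝ (Fin n)}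
    (ha : 0 ≤ a) (ht : 0 ≤ t) (h1 : 1 ≤ (p x).toReal) (hP : (p x).toReal ≤ P) :
    phiShift p a x t ≤ P * shiftPow a (p x).toReal t := by
  rw [phiShift_eq ha ht, intervalIntegral.integral_const_mul]
  have h : ∫ τ in (0 : ℝ)..t, shiftSlope a (p x).toReal τ ≤
      ∫ τ in (0 : ℝ)..t, shiftSlope a (p x).toReal t :=
    intervalIntegral.integral_mono_on ht (intervalIntegrable_shiftSlope ha h1 le_rfl ht)
      (by simp) fun τ hτ => shiftSlope_mono ha h1 hτ.1 hτ.2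
  rw [intervalIntegral.integral_const, sub_zero, smul_eq_mul, mul_comm t] at h
  exact mul_le_mul hP h (intervalIntegral.integral_nonneg ht fun τ hτ =>
    shiftSlope_nonneg ha hτ.1) (by linarith)

/-- The upper half `[t/2, t]` of the interval already suffices: the slope there is at least its
value at `t/2`, which doubling compares with the value at `t`. -/
lemma le_phiShift {p : EuclideanSpace ℝ (Fin n) → ℝ≥0∞} {a t P : ℝ} {x : EuclideanSpace ℝ (Fin n)}
    (ha : 0 ≤ a) (ht : 0 ≤ t) (h1 : 1 ≤ (p x).toReal) (hP : (p x).toReal ≤ P) :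
    shiftPow a (p x).toReal t ≤ 2 ^ (P + 1) * phiShift p a x t := by
  set q := (p x).toReal with hq
  have hint := fun s t hs ht => intervalIntegrable_shiftSlope (a := a) (q := q) (s := s) (t := t)
    ha h1 hs ht
  have h2 : 0 ≤ t / 2 := by linarith
  have hA : (t / 2) * shiftSlope a q (t / 2) ≤ ∫ τ in (t / 2)..t, shiftSlope a q τ := by
    have h : ∫ τ in (t / 2)..t, shiftSlope a q (t / 2) ≤ ∫ τ in (t / 2)..t, shiftSlope a q τ :=
      intervalIntegral.integral_mono_on (by linarith) (by simp) (hint _ _ h2 ht)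
        fun τ hτ => shiftSlope_mono ha h1 h2 hτ.1
    rw [intervalIntegral.integral_const, smul_eq_mul] at h
    convert h using 2; ring
  have hB : ∫ τ in (t / 2)..t, shiftSlope a q τ ≤ ∫ τ in (0 : ℝ)..t, shiftSlope a q τ := by
    rw [← intervalIntegral.integral_add_adjacent_intervals (hint 0 (t / 2) le_rfl h2)
      (hint _ _ h2 ht)]
    have := intervalIntegral.integral_nonneg (μ := volume) h2
      (fun τ (hτ : τ ∈ Set.Icc 0 (t / 2)) => shiftSlope_nonneg (q := q) ha hτ.1)
    linarith
  have hC : ∫ τ in (0 : ℝ)..t, shiftSlope a q τ ≤ phiShift p a x t := by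
    rw [phiShift_eq ha ht, intervalIntegral.integral_const_mul]
    exact le_mul_of_one_le_left (intervalIntegral.integral_nonneg ht fun τ hτ =>
      shiftSlope_nonneg ha hτ.1) h1
  have hD := shiftSlope_mul_le (q := q) ha h1 h2 one_le_two
  rw [mul_div_cancel₀ t (two_ne_zero)] at hD
  have hE : (2 : ℝ) ^ (q + 1) ≤ 2 ^ (P + 1) :=
    Real.rpow_le_rpow_of_exponent_le one_le_two (by linarith)
  have hF : 0 ≤ (t / 2) * shiftSlope a q (t / 2) := mul_nonneg h2 (shiftSlope_nonneg ha h2)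
  calc shiftPow a q t ≤ (2 ^ q * shiftSlope a q (t / 2)) * t :=
        mul_le_mul_of_nonneg_right hD ht
    _ = 2 ^ (q + 1) * ((t / 2) * shiftSlope a q (t / 2)) := by
        rw [Real.rpow_add_one two_ne_zero]; ring
    _ ≤ 2 ^ (P + 1) * phiShift p a x t :=
        mul_le_mul hE (by linarith) hF (by positivity)

/-! ### Averages and change of exponent on a probability space -/

/-- A substitute for Jensen's inequality. -/
lemma shiftPow_half_le_lintegral {α : Type*} [MeasurableSpace α] {μ : Measure α}
    [IsProbabilityMeasure μ] {a q F : ℝ} {f : α → ℝ} (ha : 0 ≤ a) (hq : 1 ≤ q) (hF : 0 ≤ F)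
    (hf : ∀ y, 0 ≤ f y) (h : ENNReal.ofReal F ≤ ∫⁻ y, ENNReal.ofReal (f y) ∂μ) :
    ENNReal.ofReal (shiftPow a q (F / 2)) ≤ ∫⁻ y, ENNReal.ofReal (shiftPow a q (f y)) ∂μ := by
  have hF2 : 0 ≤ F / 2 := by linarith
  set k := shiftSlope a q (F / 2) with hk
  have hk0 : 0 ≤ k := shiftSlope_nonneg ha hF2
  -- Where `f y ≥ F / 2` the slope at `f y` is at least `k`; elsewhere `k * f y` is at most half of
  -- `k * F`, which is absorbed after integration. Neither convexity nor measurability of `f` is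
  -- used.
  have hpt : ∀ y, k * f y ≤ shiftPow a q (f y) + k * (F / 2) := by
    intro y
    rcases le_total (f y) (F / 2) with h' | h'
    · nlinarith [shiftPow_nonneg (q := q) ha (hf y), mul_le_mul_of_nonneg_left h' hk0]
    · have := mul_le_mul_of_nonneg_right (shiftSlope_mono (q := q) ha hq hF2 h') (hf y)
      unfold shiftPow
      nlinarith [mul_nonneg hk0 hF2]
  have h1 : ENNReal.ofReal k * ∫⁻ y, ENNReal.ofReal (f y) ∂μ ≤
      (∫⁻ y, ENNReal.ofReal (shiftPow a q (f y)) ∂μ) + ENNReal.ofReal (k * (F / 2)) := by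
    rw [← lintegral_const_mul' _ _ ENNReal.ofReal_ne_top]
    calc _ ≤ ∫⁻ y, (ENNReal.ofReal (shiftPow a q (f y)) + ENNReal.ofReal (k * (F / 2))) ∂μ := by
          refine lintegral_mono fun y => ?_
          rw [← ENNReal.ofReal_mul hk0, ← ENNReal.ofReal_add (shiftPow_nonneg ha (hf y))
            (mul_nonneg hk0 hF2)]
          exact ENNReal.ofReal_le_ofReal (hpt y)
      _ = _ := by rw [lintegral_add_right _ measurable_const]; simp
  have h2 : ENNReal.ofReal (k * (F / 2)) + ENNReal.ofReal (k * (F / 2)) ≤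
      ENNReal.ofReal k * ∫⁻ y, ENNReal.ofReal (f y) ∂μ := by
    rw [← ENNReal.ofReal_add (mul_nonneg hk0 hF2) (mul_nonneg hk0 hF2)]
    calc _ = ENNReal.ofReal k * ENNReal.ofReal F := by
          rw [← ENNReal.ofReal_mul hk0]; congr 1; ring
      _ ≤ _ := by gcongr
  exact (ENNReal.add_le_add_iff_right ENNReal.ofReal_ne_top).1 (h2.trans h1)

/-- The mechanism of log-Hölder continuity: `X ^ (1 / log X) = e`, so a power of `X` raised to an
exponent of order `1 / log X` stays bounded. Since `log X ≥ 1`, also `ε ≤ L`, which handles the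
factor `A`. -/
lemma rpow_le_of_le_div_log {X A N L ε b : ℝ} (hX : Real.exp 1 ≤ X) (hA : 1 ≤ A) (hN : 0 ≤ N)
    (hε0 : 0 ≤ ε) (hε : ε ≤ L / Real.log X) (hb : 0 ≤ b) (hbX : b ≤ A * X ^ N) :
    b ^ ε ≤ A ^ L * Real.exp (N * L) := by
  have hX0 : 0 < X := (Real.exp_pos 1).trans_le hX
  have hlog : 1 ≤ Real.log X := by rwa [Real.le_log_iff_exp_le hX0]
  have h1 : ε * Real.log X ≤ L := by rwa [le_div_iff₀ (by linarith)] at hε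
  have h2 : ε ≤ L := by nlinarith
  calc b ^ ε ≤ (A * X ^ N) ^ ε := Real.rpow_le_rpow hb hbX hε0
    _ = A ^ ε * (X ^ N) ^ ε := Real.mul_rpow (by linarith) (by positivity)
    _ ≤ A ^ L * Real.exp (N * L) := by
      refine mul_le_mul (Real.rpow_le_rpow_of_exponent_le hA h2) ?_ (by positivity) (by positivity)
      rw [← Real.rpow_mul hX0.le, Real.rpow_def_of_pos hX0]
      apply Real.exp_le_exp.2
      nlinarith

/-- Lowering the exponent on a set where it oscillates little. -/
lemma shiftPow_le_of_exponent_le {a q r t P Λ δ B D ε : ℝ} (ha : 0 ≤ a) (ht : 0 ≤ t)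
    (hq : 1 ≤ q) (hqr : q ≤ r) (hε : r - q ≤ ε) (hqP : q ≤ P) (hΛ : 1 ≤ Λ) (hδ : 0 < δ)
    (hδΛ : δ⁻¹ ≤ Λ) (hB : Λ ^ ε ≤ B) (hD : 1 ≤ D) (hδD : δ ≤ D) :
    shiftPow a q t ≤ B * shiftPow a r t + D ^ P * δ := by
  have hB0 : 0 ≤ B := le_trans (by positivity) hB
  rcases le_or_gt δ (a + t) with h | h
  · have hpos : 0 < a + t := hδ.trans_le h
    rcases ht.eq_or_lt with rfl | ht
    · simp only [shiftPow, mul_zero, zero_add]; positivity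
    have h1 : (a + t) ^ (q - r) ≤ B := by
      calc (a + t) ^ (q - r) = ((a + t)⁻¹) ^ (r - q) := by
            rw [Real.inv_rpow hpos.le, ← Real.rpow_neg hpos.le]; congr 1; ring
        _ ≤ Λ ^ (r - q) := Real.rpow_le_rpow (by positivity)
            ((inv_anti₀ hδ h).trans hδΛ) (by linarith)
        _ ≤ Λ ^ ε := Real.rpow_le_rpow_of_exponent_le hΛ hε
        _ ≤ B := hB
    rw [shiftPow_eq_rpow_mul (q := r) ha ht]
    have := mul_le_mul_of_nonneg_right h1 (shiftPow_nonneg (q := r) ha ht.le)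
    have : 0 ≤ D ^ P * δ := by positivity
    linarith
  -- Below the threshold no comparison of exponents is needed: the whole value is at most `δ ^ q = δ
  -- ^ (q - 1) * δ`, an admissible error.
  · have h1 : shiftPow a q t ≤ D ^ P * δ := by
      calc shiftPow a q t ≤ (a + t) ^ q := shiftPow_le_rpow ha ht
        _ ≤ δ ^ q := Real.rpow_le_rpow (by positivity) h.le (by linarith)
        _ = δ ^ (q - 1) * δ := by rw [← Real.rpow_add_one hδ.ne']; simp
        _ ≤ D ^ P * δ := by
          refine mul_le_mul_of_nonneg_right ?_ hδ.le
          exact (Real.rpow_le_rpow hδ.le hδD (by linarith)).trans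
            (Real.rpow_le_rpow_of_exponent_le hD (by linarith))
    have := mul_nonneg hB0 (shiftPow_nonneg (q := r) ha ht)
    linarith

/-- The key estimate, for an abstract probability space. -/
lemma shiftPow_average_le {α : Type*} [MeasurableSpace α] {μ : Measure α}
    [IsProbabilityMeasure μ] {a q F P Λ δ B D ε : ℝ} {f r : α → ℝ} (ha : 0 ≤ a) (hq : 1 ≤ q)
    (hqP : q ≤ P) (hε0 : 0 ≤ ε) (hr : ∀ y, 1 ≤ r y) (hrq : ∀ᵐ y ∂μ, |r y - q| ≤ ε)
    (hF : 0 ≤ F) (hf : ∀ y, 0 ≤ f y) (h : ENNReal.ofReal F ≤ ∫⁻ y, ENNReal.ofReal (f y) ∂μ)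
    (hFΛ : a + F ≤ Λ) (hΛ : 1 ≤ Λ) (hδ : 0 < δ) (hδΛ : δ⁻¹ ≤ Λ) (hB : Λ ^ (2 * ε) ≤ B)
    (hD : 1 ≤ D) (hδD : δ ≤ D) :
    ENNReal.ofReal (shiftPow a q (F / 2)) ≤
      ENNReal.ofReal (B ^ 2) * (∫⁻ y, ENNReal.ofReal (shiftPow a (r y) (f y)) ∂μ) +
        ENNReal.ofReal (B * D ^ P * δ) := by
  have hB0 : 0 ≤ B := le_trans (by positivity) hB
  -- `q'` lies below both `q` and almost every `r y`, within `2 * ε` of each. The Jensen substitute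
  -- is applied at this constant exponent; one factor `B` pays for raising `q'` to `q` at the
  -- average, another for replacing `r y` by `q'` under the integral.
  set q' := max 1 (q - ε) with hq'
  have h1 : 1 ≤ q' := le_max_left _ _
  have h2 : q' ≤ q := max_le hq (by linarith)
  have h3 : q - q' ≤ ε := by have := le_max_right 1 (q - ε); linarith
  have hF2 : 0 ≤ F / 2 := by linarith
  have hup : shiftPow a q (F / 2) ≤ B * shiftPow a q' (F / 2) := by
    rcases hF2.eq_or_lt with h0 | h0
    · simp [← h0, shiftPow]
    · rw [shiftPow_eq_rpow_mul (q := q') ha h0]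
      refine mul_le_mul_of_nonneg_right ?_ (shiftPow_nonneg ha hF2)
      calc (a + F / 2) ^ (q - q') ≤ Λ ^ (q - q') :=
            Real.rpow_le_rpow (by positivity) (by linarith) (by linarith)
        _ ≤ Λ ^ (2 * ε) := Real.rpow_le_rpow_of_exponent_le hΛ (by linarith)
        _ ≤ B := hB
  have hlow : ∀ᵐ y ∂μ, shiftPow a q' (f y) ≤ B * shiftPow a (r y) (f y) + D ^ P * δ := by
    filter_upwards [hrq] with y hy
    have h4 := abs_le.1 hy
    refine shiftPow_le_of_exponent_le ha (hf y) h1 (max_le (hr y) (by linarith [h4.1])) ?_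
      (h2.trans hqP) hΛ hδ hδΛ hB hD hδD
    linarith [h4.2]
  have hDδ : 0 ≤ D ^ P * δ := by positivity
  calc ENNReal.ofReal (shiftPow a q (F / 2))
      ≤ ENNReal.ofReal B * ENNReal.ofReal (shiftPow a q' (F / 2)) := by
        rw [← ENNReal.ofReal_mul hB0]; exact ENNReal.ofReal_le_ofReal hup
    _ ≤ ENNReal.ofReal B * ∫⁻ y, ENNReal.ofReal (shiftPow a q' (f y)) ∂μ := by
        gcongr; exact shiftPow_half_le_lintegral ha h1 hF hf h
    _ ≤ ENNReal.ofReal B * ∫⁻ y, (ENNReal.ofReal B * ENNReal.ofReal (shiftPow a (r y) (f y)) +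
          ENNReal.ofReal (D ^ P * δ)) ∂μ := by
        refine mul_le_mul_right (lintegral_mono_ae ?_) _
        filter_upwards [hlow] with y hy
        rw [← ENNReal.ofReal_mul hB0, ← ENNReal.ofReal_add
          (mul_nonneg hB0 (shiftPow_nonneg ha (hf y))) hDδ]
        exact ENNReal.ofReal_le_ofReal hy
    _ = _ := by
        rw [lintegral_add_right _ measurable_const, lintegral_const_mul' _ _ ENNReal.ofReal_ne_top,
          lintegral_const, measure_univ, mul_one, mul_add, ← mul_assoc,
          ← ENNReal.ofReal_mul hB0, ← ENNReal.ofReal_mul hB0, sq, mul_assoc B]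

/-! ### Consequences of log-Hölder continuity of `1/p` -/

lemma IsLogHolderWith.continuous {c : ℝ} {g : EuclideanSpace ℝ (Fin n) → ℝ}
    (h : IsLogHolderWith c g) : Continuous g := by
  rw [continuous_iff_continuousAt]
  intro x
  rw [continuousAt_iff_punctured_nhds]
  rw [tendsto_iff_dist_tendsto_zero]
  have h1 : Tendsto (fun y : EuclideanSpace ℝ (Fin n) => ‖y - x‖⁻¹) (𝓝[≠] x) atTop :=
    tendsto_inv_nhdsGT_zero.comp (tendsto_norm_sub_self_nhdsNE x)
  have h2 : Tendsto (fun y => c / Real.log (Real.exp 1 + 1 / ‖y - x‖)) (𝓝[≠] x) (𝓝 0) := by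
    refine Tendsto.const_div_atTop (Real.tendsto_log_atTop.comp ?_) c
    refine tendsto_atTop_mono (fun y => ?_) h1
    rw [one_div]
    linarith [Real.exp_pos 1]
  refine squeeze_zero' (Eventually.of_forall fun y => dist_nonneg) ?_ h2
  filter_upwards [self_mem_nhdsWithin] with y hy
  rw [Real.dist_eq]
  exact h.2.1 y x hy

/-- The essential bound holds on a set of full measure, hence on a dense set; continuity of `1/p`
carries the bound `1/p ≥ 1/P` to every point and excludes the value `∞`. -/
lemma exponent_bounds {p : EuclideanSpace ℝ (Fin n) → ℝ≥0∞} (hp : IsLogHolderExponent p)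
    {P : ℝ≥0} (hP : pPlus p ≤ P) (x : EuclideanSpace ℝ (Fin n)) :
    p x ≠ ∞ ∧ 1 ≤ (p x).toReal ∧ (p x).toReal ≤ P := by
  obtain ⟨⟨-, h1⟩, c, hc⟩ := hp
  have hae : ∀ᵐ y ∂(volume : Measure (EuclideanSpace ℝ (Fin n))), p y ≤ P := by
    filter_upwards [ENNReal.ae_le_essSup p] with y hy using hy.trans hP
  have hd := Measure.dense_of_ae hae
  obtain ⟨y₀, hy₀⟩ := hd.nonempty
  have hP1 : (1 : ℝ≥0∞) ≤ P := (h1 y₀).trans hy₀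
  have hP1' : (1 : ℝ) ≤ P := by exact_mod_cast hP1
  have hcl : IsClosed {y | (P : ℝ)⁻¹ ≤ recip p y} := isClosed_le continuous_const hc.continuous
  have hx : (P : ℝ)⁻¹ ≤ recip p x := by
    have : closure {y | p y ≤ P} ⊆ {y | (P : ℝ)⁻¹ ≤ recip p y} := by
      refine closure_minimal (fun y hy => ?_) hcl
      have hyt : p y ≠ ∞ := ne_top_of_le_ne_top ENNReal.coe_ne_top hy
      have hy1 := ENNReal.toReal_mono hyt (h1 y)
      have hyP := ENNReal.toReal_mono ENNReal.coe_ne_top (show p y ≤ P from hy)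
      change (P : ℝ)⁻¹ ≤ recip p y
      simp only [recip, ENNReal.toReal_inv]
      simp only [ENNReal.toReal_one, ENNReal.coe_toReal] at hy1 hyP
      exact inv_anti₀ (by linarith) hyP
    exact this (hd.closure_eq ▸ Set.mem_univ x)
  have hpos : 0 < recip p x := lt_of_lt_of_le (by positivity) hx
  have hxt : p x ≠ ∞ := by
    intro h; simp [recip, h] at hpos
  have hx1 := ENNReal.toReal_mono hxt (h1 x)
  rw [ENNReal.toReal_one] at hx1
  refine ⟨hxt, hx1, ?_⟩
  simp only [recip, ENNReal.toReal_inv] at hx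
  exact (inv_le_inv₀ (by linarith) (by linarith)).1 hx

/-- The modulus of continuity passes from `1/p` to `p` through `|s - t| = s t |1/s - 1/t|` with `s,
t ≤ P`. -/
lemma exponent_abs_sub_le {p : EuclideanSpace ℝ (Fin n) → ℝ≥0∞} (hp : IsLogHolderExponent p)
    {K P : ℝ≥0} (hK : cLog p ≤ K) (hP : pPlus p ≤ P) {x y : EuclideanSpace ℝ (Fin n)} {d : ℝ}
    (hd : 0 < d) (hxy : ‖x - y‖ ≤ d) :
    |(p x).toReal - (p y).toReal| ≤ P ^ 2 * (K + 1) / Real.log (Real.exp 1 + 1 / d) := by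
  have hlog : ∀ {t : ℝ}, 0 < t → 0 < Real.log (Real.exp 1 + 1 / t) := fun {t} ht => by
    apply Real.log_pos
    have := Real.add_one_lt_exp (one_ne_zero)
    have : 0 < 1 / t := by positivity
    linarith
  rcases eq_or_ne x y with rfl | hne
  · simp only [sub_self, abs_zero]
    have := hlog hd
    positivity
  -- Settling for a constant below `K + 1` avoids having to show that the infimum `cLog p` is
  -- attained.
  obtain ⟨c, hc, hcK⟩ : ∃ c, IsLogHolderWith c (recip p) ∧ c < K + 1 := by
    have := exists_lt_of_csInf_lt (s := {c | IsLogHolderWith c (recip p)}) hp.2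
      (b := (K : ℝ) + 1) (lt_of_le_of_lt hK (by linarith))
    exact this
  have hn : 0 < ‖x - y‖ := norm_pos_iff.2 (sub_ne_zero.2 hne)
  obtain ⟨-, hx1, hxP⟩ := exponent_bounds hp hP x
  obtain ⟨-, hy1, hyP⟩ := exponent_bounds hp hP y
  have h := hc.2.1 x y hne
  simp only [recip, ENNReal.toReal_inv] at h
  set s := (p x).toReal
  set t := (p y).toReal
  have heq : |s - t| = s * t * |s⁻¹ - t⁻¹| := by
    have hs0 : s ≠ 0 := by positivity
    have ht0 : t ≠ 0 := by positivity
    have : s⁻¹ - t⁻¹ = (t - s) / (s * t) := by field_simp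
    rw [this, abs_div, abs_of_pos (show 0 < s * t by positivity), abs_sub_comm]
    field_simp
  have hle : c / Real.log (Real.exp 1 + 1 / ‖x - y‖) ≤ (K + 1) / Real.log (Real.exp 1 + 1 / d) := by
    have h1 := hlog hd
    have h2 : Real.log (Real.exp 1 + 1 / d) ≤ Real.log (Real.exp 1 + 1 / ‖x - y‖) := by
      apply Real.log_le_log (by positivity)
      gcongr
    exact div_le_div₀ (by positivity) hcK.le h1 h2
  calc |s - t| = s * t * |s⁻¹ - t⁻¹| := heq
    _ ≤ (P * P) * ((K + 1) / Real.log (Real.exp 1 + 1 / d)) := by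
      gcongr
      exact h.trans hle
    _ = _ := by ring

/-! ### Dilated kernels and their dependence on the scale -/

open scoped ContDiff

/-- The `L¹`-normalised dilation of `θ` by the factor `s`, centred at `x`. -/
noncomputable def dilate (s : ℝ) (x : EuclideanSpace ℝ (Fin n))
    (θ : EuclideanSpace ℝ (Fin n) → ℝ) (y : EuclideanSpace ℝ (Fin n)) : ℝ :=
  (s ^ n)⁻¹ * θ (s⁻¹ • (y - x))

/-- The divergence of `ζ ↦ θ ζ • ζ`. -/
noncomputable def divRadial (θ : EuclideanSpace ℝ (Fin n) → ℝ) (ζ : EuclideanSpace ℝ (Fin n)) : ℝ :=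
  n * θ ζ + fderiv ℝ θ ζ ζ

lemma contDiff_divRadial {θ : EuclideanSpace ℝ (Fin n) → ℝ} (hθ : ContDiff ℝ ∞ θ) :
    ContDiff ℝ ∞ (divRadial θ) :=
  (contDiff_const.mul hθ).add ((hθ.fderiv_right (by simp)).clm_apply contDiff_id)

lemma hasCompactSupport_divRadial {θ : EuclideanSpace ℝ (Fin n) → ℝ} (hθ : HasCompactSupport θ) :
    HasCompactSupport (divRadial θ) := by
  refine hθ.mono' fun ζ hζ => ?_
  by_contra h
  apply hζ
  have h1 : θ ζ = 0 := image_eq_zero_of_notMem_tsupport h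
  have h2 : fderiv ℝ θ ζ = 0 := by
    by_contra h'
    exact h (support_fderiv_subset ℝ h')
  simp [divRadial, h1, h2]

lemma hasDerivAt_dilate {θ : EuclideanSpace ℝ (Fin n) → ℝ} (hθ : Differentiable ℝ θ) {s : ℝ}
    (hs : 0 < s) (x y : EuclideanSpace ℝ (Fin n)) :
    HasDerivAt (fun s => dilate s x θ y) (-s⁻¹ * dilate s x (divRadial θ) y) s := by
  have h1 : HasDerivAt (fun s : ℝ => (s ^ n)⁻¹) (-(n * s ^ (n - 1)) / (s ^ n) ^ 2) s :=
    (hasDerivAt_pow n s).inv (by positivity)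
  have h2 : HasDerivAt (fun s : ℝ => s⁻¹ • (y - x)) (-(s ^ 2)⁻¹ • (y - x)) s :=
    (hasDerivAt_inv hs.ne').smul_const _
  have h3 := (hθ (s⁻¹ • (y - x))).hasFDerivAt.comp_hasDerivAt s h2
  refine (h1.mul h3).congr_deriv ?_
  simp only [dilate, divRadial, Function.comp, map_smul, smul_eq_mul]
  rcases n with _ | k
  · simp; field_simp
  · simp only [Nat.add_sub_cancel]
    field_simp
    ring

lemma contDiff_dilate {θ : EuclideanSpace ℝ (Fin n) → ℝ} (hθ : ContDiff ℝ ∞ θ) (s : ℝ)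
    (x : EuclideanSpace ℝ (Fin n)) : ContDiff ℝ ∞ (dilate s x θ) :=
  contDiff_const.mul (hθ.comp ((contDiff_id.sub contDiff_const).const_smul s⁻¹))

lemma fderiv_dilate {θ : EuclideanSpace ℝ (Fin n) → ℝ} (hθ : Differentiable ℝ θ) (s : ℝ)
    (x y v : EuclideanSpace ℝ (Fin n)) :
    fderiv ℝ (dilate s x θ) y v = s⁻¹ * dilate s x (fun ζ => fderiv ℝ θ ζ v) y := by
  have h2 : HasFDerivAt (fun y => s⁻¹ • (y - x))
      (s⁻¹ • ContinuousLinearMap.id ℝ (EuclideanSpace ℝ (Fin n))) y :=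
    ((hasFDerivAt_id y).sub_const x).const_smul s⁻¹
  have h3 := ((hθ (s⁻¹ • (y - x))).hasFDerivAt.comp y h2).const_mul ((s ^ n)⁻¹)
  have h4 : fderiv ℝ (dilate s x θ) y = _ := h3.fderiv
  rw [h4]
  simp [dilate]
  ring

lemma hasDerivAt_integral_dilate {Q : Set (EuclideanSpace ℝ (Fin n))}
    {u θ : EuclideanSpace ℝ (Fin n) → ℝ}
    (hu : IntegrableOn u Q) (hθ : ContDiff ℝ ∞ θ) (hc : HasCompactSupport θ) {s : ℝ} (hs : 0 < s)
    (x : EuclideanSpace ℝ (Fin n)) :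
    HasDerivAt (fun s => ∫ y in Q, u y * dilate s x θ y)
      (-s⁻¹ * ∫ y in Q, u y * dilate s x (divRadial θ) y) s := by
  obtain ⟨A, hA⟩ := hc.exists_bound_of_continuous hθ.continuous
  obtain ⟨B, hB⟩ := (hasCompactSupport_divRadial hc).exists_bound_of_continuous
    (contDiff_divRadial hθ).continuous
  have hB0 : 0 ≤ B := (norm_nonneg _).trans (hB 0)
  have hs2 : 0 < s / 2 := by linarith
  have hmeas : ∀ (s : ℝ) {η : EuclideanSpace ℝ (Fin n) → ℝ}, ContDiff ℝ ∞ η →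
      AEStronglyMeasurable (fun y => u y * dilate s x η y) (volume.restrict Q) := fun s η hη =>
    hu.1.mul (contDiff_dilate hη s x).continuous.aestronglyMeasurable
  -- Staying at scales above `s / 2` bounds the factors `t⁻¹` and `(t ^ n)⁻¹` uniformly, so a
  -- multiple of `|u|` dominates.
  have key := hasDerivAt_integral_of_dominated_loc_of_deriv_le (μ := volume.restrict Q)
    (F := fun s y => u y * dilate s x θ y)
    (F' := fun s y => u y * (-s⁻¹ * dilate s x (divRadial θ) y))
    (bound := fun y => ‖u y‖ * ((s / 2)⁻¹ * (((s / 2) ^ n)⁻¹ * B)))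
    (s := Set.Ioi (s / 2)) (x₀ := s) (Ioi_mem_nhds (by linarith))
    (Eventually.of_forall fun s => hmeas s hθ) ?_ ?_ ?_ ?_ ?_
  · refine key.2.congr_deriv ?_
    rw [← integral_const_mul]
    congr 1 with y
    ring
  · refine Integrable.mono' (hu.norm.mul_const ((s ^ n)⁻¹ * A)) (hmeas s hθ)
      (Eventually.of_forall fun y => ?_)
    rw [norm_mul, dilate, norm_mul, Real.norm_of_nonneg (by positivity : 0 ≤ (s ^ n)⁻¹)]
    gcongr
    exact hA _
  · refine ((hmeas s (contDiff_divRadial hθ)).const_mul (-s⁻¹)).congr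
      (Eventually.of_forall fun y => ?_)
    simp only
    ring
  · refine Eventually.of_forall fun y t ht => ?_
    have ht : s / 2 < t := ht
    have ht0 : 0 < t := hs2.trans ht
    rw [norm_mul, norm_mul, dilate, norm_mul, norm_neg, norm_inv, norm_inv, norm_pow,
      Real.norm_of_nonneg ht0.le]
    gcongr
    exact hB _
  · exact hu.norm.mul_const _
  · exact Eventually.of_forall fun y t ht =>
      (hasDerivAt_dilate (hθ.differentiable (by simp)) (hs2.trans ht) x y).const_mul _

lemma continuousOn_integral_dilate {Q : Set (EuclideanSpace ℝ (Fin n))}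
    {u θ : EuclideanSpace ℝ (Fin n) → ℝ}
    (hu : IntegrableOn u Q) (hθ : ContDiff ℝ ∞ θ) (hc : HasCompactSupport θ)
    (x : EuclideanSpace ℝ (Fin n)) :
    ContinuousOn (fun s => -s⁻¹ * ∫ y in Q, u y * dilate s x (divRadial θ) y) (Set.Ioi 0) := by
  refine (ContinuousOn.neg (continuousOn_inv₀.mono fun s hs => ?_)).mul fun s hs => ?_
  · exact (ne_of_gt hs : s ≠ 0)
  · exact (hasDerivAt_integral_dilate hu (contDiff_divRadial hθ) (hasCompactSupport_divRadial hc)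
      hs x).continuousAt.continuousWithinAt

/-! ### The kernels of the averaged rigid motion and of the symmetric gradient -/

/-- The kernel acting on `u` in the averaged rigid motion. -/
noncomputable def motionKernel (η : EuclideanSpace ℝ (Fin n) → ℝ) (i l : Fin n)
    (ζ : EuclideanSpace ℝ (Fin n)) : ℝ :=
  (if l = i then (1 / 2) * (η ζ + divRadial η ζ) else 0) -
    (1 / 2) * (ζ l * fderiv ℝ η ζ (EuclideanSpace.single i 1))

/-- The kernel acting on the symmetric gradient. -/
noncomputable def strainKernel (η : EuclideanSpace ℝ (Fin n) → ℝ) (i l m : Fin n)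
    (ζ : EuclideanSpace ℝ (Fin n)) : ℝ :=
  (1 / 2) * (((if l = i then ζ m else 0) + (if m = i then ζ l else 0)) * divRadial η ζ) -
    ζ l * ζ m * fderiv ℝ η ζ (EuclideanSpace.single i 1)

lemma strainKernel_comm (η : EuclideanSpace ℝ (Fin n) → ℝ) (i l m : Fin n) :
    strainKernel η i l m = strainKernel η i m l := by
  ext ζ; unfold strainKernel; ring

lemma contDiff_apply_coord (l : Fin n) :
    ContDiff ℝ ∞ (fun ζ : EuclideanSpace ℝ (Fin n) => ζ l) :=
  (EuclideanSpace.proj (𝕜 := ℝ) l).contDiff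

lemma contDiff_fderiv_apply {η : EuclideanSpace ℝ (Fin n) → ℝ} (hη : ContDiff ℝ ∞ η)
    (v : EuclideanSpace ℝ (Fin n)) : ContDiff ℝ ∞ (fun ζ => fderiv ℝ η ζ v) :=
  (hη.fderiv_right (by simp)).clm_apply contDiff_const

lemma contDiff_motionKernel {η : EuclideanSpace ℝ (Fin n) → ℝ} (hη : ContDiff ℝ ∞ η)
    (i l : Fin n) : ContDiff ℝ ∞ (motionKernel η i l) := by
  refine ContDiff.sub ?_ (contDiff_const.mul ((contDiff_apply_coord l).mul
    (contDiff_fderiv_apply hη _)))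
  split_ifs
  · exact contDiff_const.mul (hη.add (contDiff_divRadial hη))
  · exact contDiff_const

lemma contDiff_strainKernel {η : EuclideanSpace ℝ (Fin n) → ℝ} (hη : ContDiff ℝ ∞ η)
    (i l m : Fin n) : ContDiff ℝ ∞ (strainKernel η i l m) := by
  refine ContDiff.sub (contDiff_const.mul (ContDiff.mul (ContDiff.add ?_ ?_)
    (contDiff_divRadial hη))) (((contDiff_apply_coord l).mul (contDiff_apply_coord m)).mul
      (contDiff_fderiv_apply hη _))
  · split_ifs
    · exact contDiff_apply_coord m
    · exact contDiff_const
  · split_ifs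
    · exact contDiff_apply_coord l
    · exact contDiff_const

lemma fderiv_divRadial {η : EuclideanSpace ℝ (Fin n) → ℝ} (hη : ContDiff ℝ ∞ η)
    (ζ v : EuclideanSpace ℝ (Fin n)) :
    fderiv ℝ (divRadial η) ζ v =
      n * fderiv ℝ η ζ v + fderiv ℝ (fderiv ℝ η) ζ v ζ + fderiv ℝ η ζ v := by
  have h1 := (hη.differentiable (by simp) ζ).hasFDerivAt
  have h2 := ((hη.fderiv_right (m := ∞) (by simp)).differentiable (by simp) ζ).hasFDerivAt
  have h3 := (h1.const_mul (n : ℝ)).add (h2.clm_apply (hasFDerivAt_id ζ))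
  have h4 : fderiv ℝ (divRadial η) ζ = _ := h3.fderiv
  rw [h4]
  simp
  ring

lemma fderiv_fderiv_apply {η : EuclideanSpace ℝ (Fin n) → ℝ} (hη : ContDiff ℝ ∞ η)
    (ζ v w : EuclideanSpace ℝ (Fin n)) :
    fderiv ℝ (fun ζ => fderiv ℝ η ζ v) ζ w = fderiv ℝ (fderiv ℝ η) ζ w v := by
  have h2 := ((hη.fderiv_right (m := ∞) (by simp)).differentiable (by simp) ζ).hasFDerivAt
  have h3 := h2.clm_apply (hasFDerivAt_const v ζ)
  rw [h3.fderiv]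
  simp

lemma sum_coord_mul (L : EuclideanSpace ℝ (Fin n) →L[ℝ] ℝ) (ζ : EuclideanSpace ℝ (Fin n)) :
    ∑ m, ζ m * L (EuclideanSpace.single m 1) = L ζ := by
  have h : ζ = ∑ m, ζ m • EuclideanSpace.single m (1 : ℝ) := by
    ext j
    simp [Finset.sum_apply, Pi.single_apply]
  conv_rhs => rw [h]
  simp

/-- The radial dilation flow moves the first kernel by the divergence of the second. -/
lemma divRadial_motionKernel {η : EuclideanSpace ℝ (Fin n) → ℝ} (hη : ContDiff ℝ ∞ η)
    (i l : Fin n) (ζ : EuclideanSpace ℝ (Fin n)) :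
    divRadial (motionKernel η i l) ζ =
      ∑ m, fderiv ℝ (strainKernel η i l m) ζ (EuclideanSpace.single m 1) := by
  have hη1 := (hη.differentiable (by simp) ζ).hasFDerivAt
  have hd1 := ((contDiff_divRadial hη).differentiable (by simp) ζ).hasFDerivAt
  have hf1 := ((contDiff_fderiv_apply hη (EuclideanSpace.single i 1)).differentiable
    (by simp) ζ).hasFDerivAt
  have hc : ∀ l : Fin n, HasFDerivAt (fun ζ : EuclideanSpace ℝ (Fin n) => ζ l)
      (EuclideanSpace.proj (𝕜 := ℝ) l : EuclideanSpace ℝ (Fin n) →L[ℝ] ℝ) ζ :=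
    fun l => (EuclideanSpace.proj (𝕜 := ℝ) l).hasFDerivAt
  -- Differentiating `divRadial η` along the `i`-th axis and differentiating `∂_i η` radially give
  -- the second derivative with its arguments in opposite orders; symmetry makes these terms cancel.
  have hsymm : ∀ v w, fderiv ℝ (fderiv ℝ η) ζ v w = fderiv ℝ (fderiv ℝ η) ζ w v := fun v w =>
    ((contDiff_infty.1 hη 2).contDiffAt.isSymmSndFDerivAt (by simp)) v w
  have hM : ∀ v, fderiv ℝ (motionKernel η i l) ζ v =
      (if l = i then (1 / 2) * (fderiv ℝ η ζ v + fderiv ℝ (divRadial η) ζ v) else 0) -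
      (1 / 2) * (v l * fderiv ℝ η ζ (EuclideanSpace.single i 1) +
        ζ l * fderiv ℝ (fun ζ => fderiv ℝ η ζ (EuclideanSpace.single i 1)) ζ v) := by
    intro v
    have h2 := ((hc l).mul hf1).const_mul (1 / 2 : ℝ)
    by_cases h : l = i
    · have h3 := ((hη1.add hd1).const_mul (1 / 2 : ℝ)).sub h2
      have h4 : motionKernel η i l = fun ζ => (1 / 2) * (η ζ + divRadial η ζ) -
          (1 / 2) * (ζ l * fderiv ℝ η ζ (EuclideanSpace.single i 1)) := by
        ext ζ; simp [motionKernel, h]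
      have h5 : fderiv ℝ (motionKernel η i l) ζ = _ :=
        (congrArg (fderiv ℝ · ζ) h4).trans h3.fderiv
      rw [h5]
      simp [h]
      ring
    · have h3 := h2.const_sub 0
      have h4 : motionKernel η i l = fun ζ => 0 -
          (1 / 2) * (ζ l * fderiv ℝ η ζ (EuclideanSpace.single i 1)) := by
        ext ζ; simp [motionKernel, h]
      have h5 : fderiv ℝ (motionKernel η i l) ζ = _ :=
        (congrArg (fderiv ℝ · ζ) h4).trans h3.fderiv
      rw [h5]
      simp [h]
      ring
  have hS : ∀ m v, fderiv ℝ (strainKernel η i l m) ζ v =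
      (1 / 2) * (((if l = i then v m else 0) + (if m = i then v l else 0)) * divRadial η ζ +
        ((if l = i then ζ m else 0) + (if m = i then ζ l else 0)) *
          fderiv ℝ (divRadial η) ζ v) -
      ((v l * ζ m + ζ l * v m) * fderiv ℝ η ζ (EuclideanSpace.single i 1) +
        ζ l * ζ m * fderiv ℝ (fun ζ => fderiv ℝ η ζ (EuclideanSpace.single i 1)) ζ v) := by
    intro m v
    have hi : ∀ (q : Prop) [Decidable q] (k : Fin n),
        HasFDerivAt (fun ζ : EuclideanSpace ℝ (Fin n) => if q then ζ k else 0)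
        ((if q then EuclideanSpace.proj (𝕜 := ℝ) k else 0) :
          EuclideanSpace ℝ (Fin n) →L[ℝ] ℝ) ζ := by
      intro q _ k
      split_ifs
      · exact hc k
      · exact hasFDerivAt_const 0 ζ
    have h3 := ((((hi (l = i) m).add (hi (m = i) l)).mul hd1).const_mul (1 / 2 : ℝ)).sub
      (((hc l).mul (hc m)).mul hf1)
    have h5 : fderiv ℝ (strainKernel η i l m) ζ = _ := h3.fderiv
    rw [h5]
    split_ifs <;> simp <;> ring
  set g := divRadial η ζ with hg
  set W := fderiv ℝ η ζ (EuclideanSpace.single i 1) with hW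
  set D := fderiv ℝ (fun ζ => fderiv ℝ η ζ (EuclideanSpace.single i 1)) ζ with hD
  set L := fderiv ℝ (divRadial η) ζ with hL
  have hsum : ∀ m, fderiv ℝ (strainKernel η i l m) ζ (EuclideanSpace.single m 1) =
      (if l = i then (1 / 2) * (g + ζ m * L (EuclideanSpace.single m 1)) else 0) +
      (if m = i then (1 / 2) * ((if l = i then g else 0) + ζ l * L (EuclideanSpace.single i 1))
        else 0) -
      ((if m = l then ζ l * W else 0) + ζ l * W +
        ζ l * (ζ m * D (EuclideanSpace.single m 1))) := by
    intro m
    rw [hS]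
    rcases eq_or_ne m l with rfl | hml
    · by_cases h : m = i
      · subst h; simp; ring
      · simp [h]; ring
    · have hlm := hml.symm
      rcases eq_or_ne m i with rfl | h
      · simp [hlm, hml]; ring
      · simp [hlm, hml, h]
        split_ifs <;> ring
  have hDsum : ∑ m, ζ l * (ζ m * D (EuclideanSpace.single m 1)) = ζ l * D ζ := by
    rw [← Finset.mul_sum, sum_coord_mul]
  simp_rw [hsum]
  rw [Finset.sum_sub_distrib, Finset.sum_add_distrib, Finset.sum_add_distrib,
    Finset.sum_add_distrib, hDsum, Finset.sum_ite_eq',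
    Finset.sum_ite_eq', Finset.sum_const, Finset.card_univ, Fintype.card_fin]
  have hLi : L (EuclideanSpace.single i 1) = (n + 1) * W + D ζ := by
    rw [hL, fderiv_divRadial hη, hsymm, ← fderiv_fderiv_apply hη]; ring
  have hgg : g = n * η ζ + fderiv ℝ η ζ ζ := rfl
  rw [divRadial, hM, motionKernel, ← hg, ← hW, hLi]
  by_cases h : l = i
  · simp only [h, if_true, Finset.mem_univ, ← Finset.mul_sum, Finset.sum_add_distrib,
      sum_coord_mul, Finset.sum_const, Finset.card_univ, Fintype.card_fin, nsmul_eq_mul]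
    linear_combination (-1 / 2) * hgg
  · simp only [h, if_false, if_true, Finset.mem_univ, Finset.sum_const_zero, nsmul_eq_mul]
    ring

/-! ### Homotheties, concentration of kernels and mass of the motion kernel -/

lemma lintegral_homothety (h : EuclideanSpace ℝ (Fin n) → ℝ≥0∞) {s : ℝ} (hs : 0 < s)
    (x : EuclideanSpace ℝ (Fin n)) :
    ∫⁻ y, h (x + s • (y - x)) = ENNReal.ofReal (s ^ n)⁻¹ * ∫⁻ y, h y := by
  calc ∫⁻ y, h (x + s • (y - x)) = ∫⁻ v, h (x + s • v) :=
        lintegral_sub_right_eq_self (fun v => h (x + s • v)) x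
    _ = ∫⁻ v, h (x + v) ∂(Measure.map (s • ·) volume) :=
        ((Homeomorph.smulOfNeZero (α := EuclideanSpace ℝ (Fin n)) s
          hs.ne').measurableEmbedding.lintegral_map fun v => h (x + v)).symm
    _ = ENNReal.ofReal (s ^ n)⁻¹ * ∫⁻ v, h (x + v) := by
        rw [Measure.map_addHaar_smul _ hs.ne', lintegral_smul_measure, finrank_euclideanSpace_fin,
          abs_of_pos (by positivity), smul_eq_mul]
    _ = _ := by rw [lintegral_add_left_eq_self h x]

lemma integral_dilate (θ : EuclideanSpace ℝ (Fin n) → ℝ) {s : ℝ} (hs : 0 < s)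
    (x : EuclideanSpace ℝ (Fin n)) : ∫ y, dilate s x θ y = ∫ ζ, θ ζ := by
  unfold dilate
  rw [integral_const_mul, integral_sub_right_eq_self (fun v => θ (s⁻¹ • v)) x,
    Measure.integral_comp_inv_smul_of_nonneg _ _ hs.le, finrank_euclideanSpace_fin, smul_eq_mul,
    ← mul_assoc, inv_mul_cancel₀ (by positivity), one_mul]

lemma integrable_mul_of_hasCompactSupport {Q : Set (EuclideanSpace ℝ (Fin n))}
    {u f : EuclideanSpace ℝ (Fin n) → ℝ} (hu : IntegrableOn u Q) (hf : Continuous f)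
    (hc : HasCompactSupport f) : IntegrableOn (fun y => u y * f y) Q := by
  obtain ⟨A, hA⟩ := hc.exists_bound_of_continuous hf
  exact hu.mul_bdd hf.aestronglyMeasurable (Eventually.of_forall hA)

/-- Concentrating kernels recover the value at a Lebesgue point. -/
lemma tendsto_integral_dilate {Q : Set (EuclideanSpace ℝ (Fin n))} (hQ : MeasurableSet Q)
    {u θ : EuclideanSpace ℝ (Fin n) → ℝ} (hu : IntegrableOn u Q) (hθ : Continuous θ)
    (hc : HasCompactSupport θ) {x : EuclideanSpace ℝ (Fin n)} (hx : x ∈ Q)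
    (hL : ∀ R : ℝ, 0 < R → Tendsto (fun s : ℝ => ⨍ y in Metric.closedBall x (s * R),
      ‖Q.indicator u y - Q.indicator u x‖) (𝓝[>] 0) (𝓝 0)) :
    Tendsto (fun s => ∫ y in Q, u y * dilate s x θ y) (𝓝[>] 0) (𝓝 (u x * ∫ ζ, θ ζ)) := by
  set H := Q.indicator u with hH
  have hHi : Integrable H := hu.integrable_indicator hQ
  obtain ⟨A, hA⟩ := hc.exists_bound_of_continuous hθ
  obtain ⟨R, hR0, hR⟩ := hc.isCompact.isBounded.subset_closedBall_lt 0 (0 : EuclideanSpace ℝ (Fin n))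
  have hA0 : 0 ≤ A := (norm_nonneg _).trans (hA 0)
  set V := volume.real (Metric.closedBall (0 : EuclideanSpace ℝ (Fin n)) R) with hV
  have hbound : ∀ s : ℝ, 0 < s → ‖(∫ y in Q, u y * dilate s x θ y) - u x * ∫ ζ, θ ζ‖ ≤
      A * V * ⨍ y in Metric.closedBall x (s * R), ‖H y - H x‖ := by
    intro s hs
    have hcont : Continuous (dilate s x θ) := by unfold dilate; fun_prop
    have hsupp : ∀ y, y ∉ Metric.closedBall x (s * R) → dilate s x θ y = 0 := by
      intro y hy
      have : θ (s⁻¹ • (y - x)) = 0 := by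
        apply image_eq_zero_of_notMem_tsupport
        intro h
        have := hR h
        rw [mem_closedBall_zero_iff, norm_smul, norm_inv, Real.norm_of_nonneg hs.le,
          inv_mul_le_iff₀ hs] at this
        exact hy (by rwa [Metric.mem_closedBall, dist_eq_norm])
      simp [dilate, this]
    have hcs : HasCompactSupport (dilate s x θ) :=
      HasCompactSupport.intro (isCompact_closedBall x (s * R)) hsupp
    have h1 : ∫ y in Q, u y * dilate s x θ y = ∫ y, H y * dilate s x θ y := by
      rw [← integral_indicator hQ]
      congr 1 with y
      by_cases hy : y ∈ Q <;> simp [hH, hy]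
    have h2 : u x * ∫ ζ, θ ζ = ∫ y, H x * dilate s x θ y := by
      rw [integral_const_mul, integral_dilate θ hs, hH, Set.indicator_of_mem hx]
    have hi1 : Integrable (fun y => H y * dilate s x θ y) := by
      simpa using integrable_mul_of_hasCompactSupport (Q := Set.univ) hHi.integrableOn hcont hcs
    have hi2 : Integrable (fun y => H x * dilate s x θ y) :=
      (hcont.integrable_of_hasCompactSupport hcs).const_mul _
    rw [h1, h2, ← integral_sub hi1 hi2]
    have hVs : volume.real (Metric.closedBall x (s * R)) = s ^ n * V := by
      rw [hV, Measure.addHaar_real_closedBall _ _ (by positivity),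
        Measure.addHaar_real_closedBall _ _ hR0.le, finrank_euclideanSpace_fin]
      ring
    have hV0 : 0 < V := ENNReal.toReal_pos (Metric.measure_closedBall_pos _ _ hR0).ne'
      measure_closedBall_lt_top.ne
    have hloc : IntegrableOn (fun y => ‖H y - H x‖) (Metric.closedBall x (s * R)) :=
      (hHi.integrableOn.sub (integrableOn_const
        (measure_closedBall_lt_top).ne)).norm
    calc ‖∫ y, (H y * dilate s x θ y - H x * dilate s x θ y)‖
        ≤ ∫ y, (Metric.closedBall x (s * R)).indicator
            (fun y => ‖H y - H x‖ * ((s ^ n)⁻¹ * A)) y := by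
          refine norm_integral_le_of_norm_le
            (IntegrableOn.integrable_indicator (Integrable.mul_const hloc _)
              measurableSet_closedBall)
            (Eventually.of_forall fun y => ?_)
          by_cases hy : y ∈ Metric.closedBall x (s * R)
          · rw [Set.indicator_of_mem hy, ← sub_mul, norm_mul, dilate, norm_mul,
              Real.norm_of_nonneg (by positivity : 0 ≤ (s ^ n)⁻¹)]
            gcongr
            exact hA _
          · rw [Set.indicator_of_notMem hy, hsupp y hy]; simp
      _ = A * V * ⨍ y in Metric.closedBall x (s * R), ‖H y - H x‖ := by
          rw [integral_indicator measurableSet_closedBall, integral_mul_const,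
            setAverage_eq, hVs, smul_eq_mul]
          field_simp
  rw [tendsto_iff_norm_sub_tendsto_zero]
  refine squeeze_zero' (Eventually.of_forall fun s => norm_nonneg _)
    (eventually_mem_nhdsWithin.mono fun s hs => hbound s hs) ?_
  simpa using (hL R hR0).const_mul (A * V)

lemma integral_coord_mul_fderiv {η : EuclideanSpace ℝ (Fin n) → ℝ} (hη : ContDiff ℝ ∞ η)
    (hc : HasCompactSupport η) (i l : Fin n) :
    Integrable (fun ζ : EuclideanSpace ℝ (Fin n) =>
      ζ l * fderiv ℝ η ζ (EuclideanSpace.single i 1)) ∧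
    ∫ ζ : EuclideanSpace ℝ (Fin n), ζ l * fderiv ℝ η ζ (EuclideanSpace.single i 1) =
      -((if l = i then 1 else 0) * ∫ ζ, η ζ) := by
  have hcl : Continuous (fun ζ : EuclideanSpace ℝ (Fin n) => ζ l) :=
    (contDiff_apply_coord l).continuous
  have hcf : HasCompactSupport fun ζ => fderiv ℝ η ζ (EuclideanSpace.single i 1) :=
    hc.fderiv_apply ℝ _
  have h1 : Integrable (fun ζ : EuclideanSpace ℝ (Fin n) =>
      ζ l * fderiv ℝ η ζ (EuclideanSpace.single i 1)) :=
    (hcl.mul (contDiff_fderiv_apply hη _).continuous).integrable_of_hasCompactSupport hcf.mul_left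
  have hd : ∀ ζ, fderiv ℝ (fun ζ : EuclideanSpace ℝ (Fin n) => ζ l) ζ
      (EuclideanSpace.single i 1) = if l = i then 1 else 0 := by
    intro ζ
    have h : fderiv ℝ (fun ζ : EuclideanSpace ℝ (Fin n) => ζ l) ζ = _ :=
      (EuclideanSpace.proj (𝕜 := ℝ) l).hasFDerivAt.fderiv
    rw [h]
    simp
  refine ⟨h1, ?_⟩
  rw [integral_mul_fderiv_eq_neg_fderiv_mul_of_integrable ?_ h1
    ((hcl.mul hη.continuous).integrable_of_hasCompactSupport hc.mul_left)
    (fun _ _ => (contDiff_apply_coord l).differentiable (by simp) _)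
    (fun _ _ => hη.differentiable (by simp) _)]
  · simp_rw [hd, integral_const_mul]
  · simp_rw [hd]
    exact (hη.continuous.integrable_of_hasCompactSupport hc).const_mul _

/-- The averaged motion reproduces constants: `divRadial η` is a divergence and has zero mean, and
the two halves of the mass of `η` come from the diagonal term and from integrating `ζ_l ∂_i η` by
parts. This fixes the limit as the scale tends to zero. -/
lemma integral_motionKernel {η : EuclideanSpace ℝ (Fin n) → ℝ} (hη : ContDiff ℝ ∞ η)
    (hc : HasCompactSupport η) (i l : Fin n) :
    ∫ ζ, motionKernel η i l ζ = if l = i then ∫ ζ, η ζ else 0 := by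
  have hi := hη.continuous.integrable_of_hasCompactSupport (μ := volume) hc
  have hid := (contDiff_divRadial hη).continuous.integrable_of_hasCompactSupport (μ := volume)
    (hasCompactSupport_divRadial hc)
  have h0 : ∫ ζ, divRadial η ζ = 0 := by
    have h : ∀ ζ, divRadial η ζ =
        n * η ζ + ∑ m, ζ m * fderiv ℝ η ζ (EuclideanSpace.single m 1) := fun ζ => by
      rw [sum_coord_mul, divRadial]
    simp_rw [h]
    rw [integral_add (hi.const_mul _)
      (integrable_finsetSum _ fun m _ => (integral_coord_mul_fderiv hη hc m m).1),
      integral_const_mul, integral_finsetSum _ fun m _ => (integral_coord_mul_fderiv hη hc m m).1]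
    simp [(integral_coord_mul_fderiv hη hc _ _).2]
  unfold motionKernel
  have h2 := integral_coord_mul_fderiv hη hc i l
  by_cases h : l = i
  · simp only [h, if_true] at h2 ⊢
    have hid' : Integrable (fun ζ => η ζ + divRadial η ζ) := hi.add hid
    rw [integral_sub (hid'.const_mul _) (h2.1.const_mul _), integral_const_mul,
      integral_const_mul, integral_add hi hid, h0, h2.2]
    ring
  · simp only [h, if_false, zero_sub, zero_mul] at h2 ⊢
    rw [integral_neg, integral_const_mul, h2.2]
    simp

/-! ### Supports of the kernels and the integral representation -/

lemma fderiv_eq_zero_of_notMem_tsupport {η : EuclideanSpace ℝ (Fin n) → ℝ}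
    {ζ : EuclideanSpace ℝ (Fin n)} (h : ζ ∉ tsupport η) : fderiv ℝ η ζ = 0 := by
  by_contra h'
  exact h (support_fderiv_subset ℝ h')

lemma divRadial_eq_zero {η : EuclideanSpace ℝ (Fin n) → ℝ}
    {ζ : EuclideanSpace ℝ (Fin n)} (h : ζ ∉ tsupport η) : divRadial η ζ = 0 := by
  simp [divRadial, image_eq_zero_of_notMem_tsupport h, fderiv_eq_zero_of_notMem_tsupport h]

lemma tsupport_motionKernel_subset (η : EuclideanSpace ℝ (Fin n) → ℝ) (i l : Fin n) :
    tsupport (motionKernel η i l) ⊆ tsupport η := by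
  refine closure_minimal (fun ζ hζ => ?_) (isClosed_tsupport _)
  by_contra h
  apply hζ
  simp [motionKernel, divRadial_eq_zero h, fderiv_eq_zero_of_notMem_tsupport h,
    image_eq_zero_of_notMem_tsupport h]

lemma tsupport_strainKernel_subset (η : EuclideanSpace ℝ (Fin n) → ℝ) (i l m : Fin n) :
    tsupport (strainKernel η i l m) ⊆ tsupport η := by
  refine closure_minimal (fun ζ hζ => ?_) (isClosed_tsupport _)
  by_contra h
  apply hζ
  simp [strainKernel, divRadial_eq_zero h, fderiv_eq_zero_of_notMem_tsupport h]

lemma add_smul_mem_of_convex {Q : Set (EuclideanSpace ℝ (Fin n))} (hQ : Convex ℝ Q)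
    {x y : EuclideanSpace ℝ (Fin n)} (hx : x ∈ Q) (hy : y ∈ Q) {s : ℝ} (hs : 0 ≤ s)
    (hs1 : s ≤ 1) : x + s • (y - x) ∈ Q :=
  hQ.add_smul_sub_mem hx hy ⟨hs, hs1⟩

lemma tsupport_dilate_subset {Q : Set (EuclideanSpace ℝ (Fin n))} (hQ : Convex ℝ Q)
    {x : EuclideanSpace ℝ (Fin n)} (hx : x ∈ Q) {θ : EuclideanSpace ℝ (Fin n) → ℝ}
    (hc : HasCompactSupport θ) (hθ : ∀ ζ ∈ tsupport θ, x + ζ ∈ Q) {s : ℝ} (hs : 0 < s)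
    (hs1 : s ≤ 1) : HasCompactSupport (dilate s x θ) ∧ tsupport (dilate s x θ) ⊆ Q := by
  set C := (fun ζ => x + s • ζ) '' tsupport θ with hC
  have hCc : IsCompact C := hc.isCompact.image (by fun_prop)
  have hsub : Function.support (dilate s x θ) ⊆ C := by
    intro y hy
    refine ⟨s⁻¹ • (y - x), subset_tsupport _ fun h => hy ?_, ?_⟩
    · simp [dilate, h]
    · simp [smul_smul, mul_inv_cancel₀ hs.ne']
  refine ⟨HasCompactSupport.of_support_subset_isCompact hCc hsub,
    (closure_minimal hsub hCc.isClosed).trans ?_⟩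
  rintro _ ⟨ζ, hζ, rfl⟩
  simpa using add_smul_mem_of_convex hQ hx (hθ ζ hζ) hs.le hs1

lemma abs_apply_le_matNorm (A : Matrix (Fin n) (Fin n) ℝ) (i j : Fin n) : |A i j| ≤ matNorm A := by
  apply Real.abs_le_sqrt
  calc A i j ^ 2 ≤ ∑ j, A i j ^ 2 :=
        Finset.single_le_sum (f := fun j => A i j ^ 2) (fun _ _ => sq_nonneg _) (Finset.mem_univ j)
    _ ≤ _ := Finset.single_le_sum (f := fun i => ∑ j, A i j ^ 2)
        (fun _ _ => Finset.sum_nonneg fun _ _ => sq_nonneg _) (Finset.mem_univ i)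

/-- The derivative in `s` of the dilated averages only involves the symmetric gradient. -/
lemma sum_integral_divRadial_motionKernel {Q : Set (EuclideanSpace ℝ (Fin n))} (hQ : Convex ℝ Q)
    {u : EuclideanSpace ℝ (Fin n) → EuclideanSpace ℝ (Fin n)}
    {G : EuclideanSpace ℝ (Fin n) → Matrix (Fin n) (Fin n) ℝ}
    (hu : ∀ l, IntegrableOn (fun y => u y l) Q) (hG : ∀ l m, IntegrableOn (fun y => G y l m) Q)
    (hw : ∀ l m, IsWeakPartialDeriv Q m (fun y => u y l) (fun y => G y l m))
    {η : EuclideanSpace ℝ (Fin n) → ℝ} (hη : ContDiff ℝ ∞ η) (hc : HasCompactSupport η)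
    {x : EuclideanSpace ℝ (Fin n)} (hx : x ∈ Q) (hηQ : ∀ ζ ∈ tsupport η, x + ζ ∈ Q) (i : Fin n)
    {s : ℝ} (hs : 0 < s) (hs1 : s ≤ 1) :
    ∑ l, -s⁻¹ * ∫ y in Q, u y l * dilate s x (divRadial (motionKernel η i l)) y =
      ∫ y in Q, ∑ l, ∑ m, symPart (G y) l m * dilate s x (strainKernel η i l m) y := by
  have hcS : ∀ l m, HasCompactSupport (strainKernel η i l m) := fun l m =>
    hc.mono' ((subset_tsupport _).trans (tsupport_strainKernel_subset η i l m))
  have hdS : ∀ l m, HasCompactSupport (dilate s x (strainKernel η i l m)) ∧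
      tsupport (dilate s x (strainKernel η i l m)) ⊆ Q := fun l m =>
    tsupport_dilate_subset hQ hx (hcS l m)
      (fun ζ hζ => hηQ ζ (tsupport_strainKernel_subset η i l m hζ)) hs hs1
  have hCD : ∀ l m, ContDiff ℝ ∞ (dilate s x (strainKernel η i l m)) := fun l m =>
    contDiff_dilate (contDiff_strainKernel hη i l m) s x
  have hGi : ∀ k k' l m, IntegrableOn
      (fun y => G y k k' * dilate s x (strainKernel η i l m) y) Q := fun k k' l m =>
    integrable_mul_of_hasCompactSupport (hG k k') (hCD l m).continuous (hdS l m).1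
  have h1 : ∀ l, -s⁻¹ * ∫ y in Q, u y l * dilate s x (divRadial (motionKernel η i l)) y =
      ∑ m, ∫ y in Q, G y l m * dilate s x (strainKernel η i l m) y := by
    intro l
    have hpt : ∀ y, u y l * dilate s x (divRadial (motionKernel η i l)) y =
        s * ∑ m, u y l * fderiv ℝ (dilate s x (strainKernel η i l m)) y
          (EuclideanSpace.single m 1) := by
      intro y
      simp_rw [fderiv_dilate ((contDiff_strainKernel hη i l _).differentiable (by simp))]
      simp only [dilate, divRadial_motionKernel hη, Finset.mul_sum]
      refine Finset.sum_congr rfl fun m _ => ?_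
      field_simp
    have hi : ∀ m, Integrable (fun y => u y l * fderiv ℝ (dilate s x (strainKernel η i l m)) y
          (EuclideanSpace.single m 1)) (volume.restrict Q) := fun m =>
      integrable_mul_of_hasCompactSupport (hu l) (contDiff_fderiv_apply (hCD l m) _).continuous
        ((hdS l m).1.fderiv_apply ℝ _)
    simp_rw [hpt]
    rw [integral_const_mul, integral_finsetSum _ fun m _ => hi m, ← mul_assoc, neg_mul,
      inv_mul_cancel₀ hs.ne', neg_one_mul, ← Finset.sum_neg_distrib]
    refine Finset.sum_congr rfl fun m _ => ?_
    rw [(hw l m).2.2 _ (hCD l m) (hdS l m).1 (hdS l m).2, neg_neg]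
  simp_rw [h1]
  have h2 : ∀ y, ∑ l, ∑ m, symPart (G y) l m * dilate s x (strainKernel η i l m) y =
      ∑ l, ∑ m, G y l m * dilate s x (strainKernel η i l m) y := by
    intro y
    have h3 : ∀ l m, symPart (G y) l m * dilate s x (strainKernel η i l m) y =
        (1 / 2) * (G y l m * dilate s x (strainKernel η i l m) y) +
        (1 / 2) * (G y m l * dilate s x (strainKernel η i m l) y) := by
      intro l m
      rw [strainKernel_comm η i m l]
      simp [symPart]
      ring
    simp_rw [h3, Finset.sum_add_distrib, ← Finset.mul_sum]
    rw [Finset.sum_comm (f := fun l m => G y m l * dilate s x (strainKernel η i m l) y)]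
    ring
  simp_rw [h2]
  rw [integral_finsetSum _ fun l _ => integrable_finsetSum _ fun m _ => hGi l m l m]
  exact Finset.sum_congr rfl fun l _ => (integral_finsetSum _ fun m _ => hGi l m l m).symm

lemma enorm_integral_strainKernel_le {Q : Set (EuclideanSpace ℝ (Fin n))} (hQm : MeasurableSet Q)
    {G : EuclideanSpace ℝ (Fin n) → Matrix (Fin n) (Fin n) ℝ}
    {η : EuclideanSpace ℝ (Fin n) → ℝ}
    {x : EuclideanSpace ℝ (Fin n)} (hηQ : ∀ ζ ∈ tsupport η, x + ζ ∈ Q) (i : Fin n)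
    {M : ℝ} (hM : ∀ l m ζ, |strainKernel η i l m ζ| ≤ M)
    {f : EuclideanSpace ℝ (Fin n) → ℝ} (hf0 : ∀ y, 0 ≤ f y)
    (hfG : ∀ᵐ y ∂(volume.restrict Q), matNorm (symPart (G y)) ≤ f y)
    {s : ℝ} (hs : 0 < s) :
    ‖∫ y in Q, ∑ l, ∑ m, symPart (G y) l m * dilate s x (strainKernel η i l m) y‖ₑ ≤
      ENNReal.ofReal (n ^ 2 * M) * ∫⁻ y in Q, ENNReal.ofReal (f (x + s • (y - x))) := by
  have hM0 : 0 ≤ M := (abs_nonneg _).trans (hM i i 0)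
  -- The dilated kernel vanishes outside the copy of `Q` shrunk by `s` towards `x`. The indicator
  -- records this, so that the substitution `y ↦ x + s • (y - x)` returns an integral over exactly
  -- `Q`.
  set g : EuclideanSpace ℝ (Fin n) → ℝ≥0∞ := fun y =>
    Q.indicator 1 (x + s⁻¹ • (y - x)) *
      ENNReal.ofReal ((s ^ n)⁻¹ * (n ^ 2 * M * f y)) with hg
  have hpt : ∀ᵐ y ∂(volume.restrict Q),
      ‖∑ l, ∑ m, symPart (G y) l m * dilate s x (strainKernel η i l m) y‖ₑ ≤ g y := by
    filter_upwards [hfG] with y hy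
    by_cases h : x + s⁻¹ • (y - x) ∈ Q
    · simp only [hg, Set.indicator_of_mem h, Pi.one_apply, one_mul]
      rw [Real.enorm_eq_ofReal_abs]
      apply ENNReal.ofReal_le_ofReal
      have hterm : ∀ l m, |symPart (G y) l m * dilate s x (strainKernel η i l m) y| ≤
          (s ^ n)⁻¹ * (M * f y) := by
        intro l m
        rw [dilate, abs_mul, abs_mul, abs_of_pos (by positivity : 0 < (s ^ n)⁻¹)]
        calc _ ≤ f y * ((s ^ n)⁻¹ * M) := by
              gcongr
              · exact hf0 y
              · exact (abs_apply_le_matNorm _ l m).trans hy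
              · exact hM l m _
          _ = _ := by ring
      calc _ ≤ ∑ l : Fin n, ∑ m : Fin n, (s ^ n)⁻¹ * (M * f y) :=
            (Finset.abs_sum_le_sum_abs _ _).trans (Finset.sum_le_sum fun l _ =>
              (Finset.abs_sum_le_sum_abs _ _).trans (Finset.sum_le_sum fun m _ => hterm l m))
        _ = _ := by simp; ring
    · have h0 : ∀ l m, strainKernel η i l m (s⁻¹ • (y - x)) = 0 := fun l m =>
        image_eq_zero_of_notMem_tsupport fun h' => h (hηQ _ (tsupport_strainKernel_subset η i l m h'))
      simp [dilate, h0]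
  calc _ ≤ ∫⁻ y in Q, ‖∑ l, ∑ m, symPart (G y) l m * dilate s x (strainKernel η i l m) y‖ₑ :=
        enorm_integral_le_lintegral_enorm _
    _ ≤ ∫⁻ y in Q, g y := lintegral_mono_ae hpt
    _ ≤ ∫⁻ y, g y := setLIntegral_le_lintegral _ _
    _ = ENNReal.ofReal (s ^ n) * ∫⁻ y, g (x + s • (y - x)) := by
        rw [lintegral_homothety g hs x, ← mul_assoc, ← ENNReal.ofReal_mul (by positivity),
          mul_inv_cancel₀ (by positivity), ENNReal.ofReal_one, one_mul]
    _ = _ := by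
        rw [← lintegral_indicator hQm, ← lintegral_const_mul' _ _ ENNReal.ofReal_ne_top,
          ← lintegral_const_mul' _ _ ENNReal.ofReal_ne_top]
        congr 1 with y
        have h1 : x + s⁻¹ • (x + s • (y - x) - x) = y := by
          simp [smul_smul, inv_mul_cancel₀ hs.ne']
        simp only [hg, h1]
        by_cases hy : y ∈ Q
        · simp only [Set.indicator_of_mem hy, Pi.one_apply, one_mul]
          rw [← ENNReal.ofReal_mul (by positivity), ← ENNReal.ofReal_mul (by positivity)]
          congr 1
          field_simp
        · simp [hy]

/-- The averaged rigid motion at the point `x`, for the weight `η` translated by `x`. -/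
noncomputable def averagedMotion (Q : Set (EuclideanSpace ℝ (Fin n)))
    (η : EuclideanSpace ℝ (Fin n) → ℝ)
    (u : EuclideanSpace ℝ (Fin n) → EuclideanSpace ℝ (Fin n)) (x : EuclideanSpace ℝ (Fin n))
    (i : Fin n) (s : ℝ) : ℝ :=
  ∑ l, ∫ y in Q, u y l * dilate s x (motionKernel (fun ζ => η (x + ζ)) i l) y

/-- Fundamental theorem of calculus in the scale: the averaged motion tends to `u x i` as `s → 0` at
a Lebesgue point, and its derivative in `s` sees only the symmetric gradient. -/
lemma abs_sub_averagedMotion_le {Q : Set (EuclideanSpace ℝ (Fin n))} (hQ : Convex ℝ Q)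
    (hQm : MeasurableSet Q)
    {u : EuclideanSpace ℝ (Fin n) → EuclideanSpace ℝ (Fin n)}
    {G : EuclideanSpace ℝ (Fin n) → Matrix (Fin n) (Fin n) ℝ}
    (hu : ∀ l, IntegrableOn (fun y => u y l) Q) (hG : ∀ l m, IntegrableOn (fun y => G y l m) Q)
    (hw : ∀ l m, IsWeakPartialDeriv Q m (fun y => u y l) (fun y => G y l m))
    {η : EuclideanSpace ℝ (Fin n) → ℝ} (hη : ContDiff ℝ ∞ η) (hc : HasCompactSupport η)
    (hη1 : ∫ y, η y = 1) (hηQ : tsupport η ⊆ Q)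
    {x : EuclideanSpace ℝ (Fin n)} (hx : x ∈ Q)
    (hL : ∀ l, ∀ R : ℝ, 0 < R → Tendsto (fun s : ℝ => ⨍ y in Metric.closedBall x (s * R),
      ‖Q.indicator (fun y => u y l) y - Q.indicator (fun y => u y l) x‖) (𝓝[>] 0) (𝓝 0))
    (i : Fin n) {M : ℝ} (hM : ∀ l m ζ, |strainKernel (fun ζ => η (x + ζ)) i l m ζ| ≤ M)
    {f : EuclideanSpace ℝ (Fin n) → ℝ} (hf0 : ∀ y, 0 ≤ f y)
    (hfG : ∀ᵐ y ∂(volume.restrict Q), matNorm (symPart (G y)) ≤ f y) :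
    ‖u x i - averagedMotion Q η u x i 1‖ₑ ≤ ENNReal.ofReal (n ^ 2 * M) *
      ∫⁻ s in Set.Ioc (0 : ℝ) 1, ∫⁻ y in Q, ENNReal.ofReal (f (x + s • (y - x))) := by
  set H : EuclideanSpace ℝ (Fin n) → ℝ := fun ζ => η (x + ζ) with hH
  have hHs : ContDiff ℝ ∞ H := hη.comp (contDiff_const.add contDiff_id)
  have hHc : HasCompactSupport H := hc.comp_homeomorph (Homeomorph.addLeft x)
  have hHQ : ∀ ζ ∈ tsupport H, x + ζ ∈ Q := fun ζ hζ =>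
    hηQ (tsupport_comp_subset_preimage η (f := fun ζ => x + ζ) (by fun_prop) hζ)
  have hcM : ∀ l, HasCompactSupport (motionKernel H i l) := fun l =>
    hHc.mono' ((subset_tsupport _).trans (tsupport_motionKernel_subset H i l))
  have hMs := fun l => contDiff_motionKernel hHs i l
  set F := averagedMotion Q η u x i with hF
  set F' : ℝ → ℝ := fun s =>
    ∑ l, -s⁻¹ * ∫ y in Q, u y l * dilate s x (divRadial (motionKernel H i l)) y with hF'
  have hder : ∀ s, 0 < s → HasDerivAt F (F' s) s := fun s hs =>
    HasDerivAt.fun_sum fun l _ => hasDerivAt_integral_dilate (hu l) (hMs l) (hcM l) hs x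
  have hcont : ContinuousOn F' (Set.Ioi 0) :=
    continuousOn_finsetSum _ fun l _ => continuousOn_integral_dilate (hu l) (hMs l) (hcM l) x
  have hlim : Tendsto F (𝓝[>] 0) (𝓝 (u x i)) := by
    have h : Tendsto F (𝓝[>] 0) (𝓝 (∑ l, u x l * ∫ ζ, motionKernel H i l ζ)) :=
      tendsto_finsetSum _ fun l _ =>
        tendsto_integral_dilate hQm (hu l) (hMs l).continuous (hcM l) hx (hL l)
    have h1 : ∫ ζ, H ζ = 1 := by rw [← hη1]; exact integral_add_left_eq_self η x
    simpa [integral_motionKernel hHs hHc, h1] using h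
  have hbd : ∀ s ∈ Set.Ioc (0 : ℝ) 1, ‖F' s‖ₑ ≤ ENNReal.ofReal (n ^ 2 * M) *
      ∫⁻ y in Q, ENNReal.ofReal (f (x + s • (y - x))) := by
    intro s hs
    simp only [hF']
    rw [sum_integral_divRadial_motionKernel hQ hu hG hw hHs hHc hx hHQ i hs.1 hs.2]
    exact enorm_integral_strainKernel_le hQm hHQ i hM hf0 hfG hs.1
  -- The calculus is done on `[s, 1]` with a bound independent of `s`, so integrability of the
  -- derivative near `0` need not be known.
  refine le_of_tendsto ((hlim.sub_const (F 1)).enorm) ?_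
  filter_upwards [Ioo_mem_nhdsGT (zero_lt_one (α := ℝ))] with s hs
  have hFTC : ∫ t in s..1, F' t = F 1 - F s := by
    have hsub : Set.uIcc s 1 ⊆ Set.Ioi 0 := by
      rw [Set.uIcc_of_le hs.2.le]
      exact fun t ht => hs.1.trans_le ht.1
    exact intervalIntegral.integral_eq_sub_of_hasDerivAt (fun t ht => hder t (hsub ht))
      (hcont.mono hsub).intervalIntegrable
  rw [← enorm_neg, neg_sub, ← hFTC, intervalIntegral.integral_of_le hs.2.le]
  calc _ ≤ ∫⁻ t in Set.Ioc s 1, ‖F' t‖ₑ := enorm_integral_le_lintegral_enorm _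
    _ ≤ ∫⁻ t in Set.Ioc 0 1, ‖F' t‖ₑ :=
        lintegral_mono_set (Set.Ioc_subset_Ioc_left hs.1.le)
    _ ≤ ∫⁻ t in Set.Ioc 0 1, ENNReal.ofReal (n ^ 2 * M) *
          ∫⁻ y in Q, ENNReal.ofReal (f (x + t • (y - x))) :=
        setLIntegral_mono' measurableSet_Ioc hbd
    _ = _ := lintegral_const_mul' _ _ ENNReal.ofReal_ne_top

/-! ### Geometry of cubes and balls -/

lemma IsCubeOrBall.isOpen {Q : Set (EuclideanSpace ℝ (Fin n))} {l : ℝ} (h : IsCubeOrBall Q l) :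
    IsOpen Q := by
  obtain ⟨-, ⟨z, e, rfl⟩ | ⟨z, rfl⟩⟩ := h
  · simp only [openCube, Set.ofPred_forall]
    exact isOpen_iInter_of_finite fun i => isOpen_lt (by fun_prop) continuous_const
  · exact Metric.isOpen_ball

lemma IsCubeOrBall.convex {Q : Set (EuclideanSpace ℝ (Fin n))} {l : ℝ} (h : IsCubeOrBall Q l) :
    Convex ℝ Q := by
  obtain ⟨-, ⟨z, e, rfl⟩ | ⟨z, rfl⟩⟩ := h
  · simp only [openCube, Set.ofPred_forall]
    refine convex_iInter fun i => ?_
    have := (convex_ball (inner ℝ (e i) z) (l / 2)).linear_preimage (innerSL ℝ (e i)).toLinearMap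
    have heq : {x | |inner ℝ (e i) (x - z)| < l / 2} =
        (innerSL ℝ (e i)).toLinearMap ⁻¹' Metric.ball (inner ℝ (e i) z) (l / 2) :=
      Set.ext fun x => by
        rw [Set.mem_preimage, Metric.mem_ball, Real.dist_eq]
        simp [inner_sub_right]
    rw [heq]
    exact this
  · exact convex_ball _ _

lemma IsCubeOrBall.exists_center (hn : 1 ≤ n) {Q : Set (EuclideanSpace ℝ (Fin n))} {l : ℝ}
    (h : IsCubeOrBall Q l) : ∃ z, Metric.ball z (l / 2) ⊆ Q ∧ Q ⊆ Metric.ball z (n * l) := by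
  have hn' : (1 : ℝ) ≤ n := by exact_mod_cast hn
  obtain ⟨hl, ⟨z, e, rfl⟩ | ⟨z, rfl⟩⟩ := h
  · refine ⟨z, fun x hx i => ?_, fun x hx => ?_⟩
    · rw [Metric.mem_ball, dist_eq_norm] at hx
      refine (abs_real_inner_le_norm _ _).trans_lt ?_
      simpa using hx
    · rw [Metric.mem_ball, dist_eq_norm, ← e.sum_repr' (x - z)]
      calc ‖∑ i, inner ℝ (e i) (x - z) • e i‖ ≤ ∑ i, |inner ℝ (e i) (x - z)| := by
            refine (norm_sum_le _ _).trans (le_of_eq ?_)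
            simp [norm_smul]
        _ ≤ ∑ _i : Fin n, l / 2 := Finset.sum_le_sum fun i _ => (hx i).le
        _ < n * l := by simp; nlinarith
  · refine ⟨z, subset_rfl, Metric.ball_subset_ball (by nlinarith)⟩

lemma volume_real_ball (x : EuclideanSpace ℝ (Fin n)) {r : ℝ} (hr : 0 < r) :
    volume.real (Metric.ball x r) =
      r ^ n * volume.real (Metric.ball (0 : EuclideanSpace ℝ (Fin n)) 1) := by
  rw [Measure.real, Measure.addHaar_ball_of_pos _ _ hr, ENNReal.toReal_mul,
    finrank_euclideanSpace_fin, ENNReal.toReal_ofReal (by positivity), Measure.real]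

lemma volume_real_unitBall_pos :
    0 < volume.real (Metric.ball (0 : EuclideanSpace ℝ (Fin n)) 1) :=
  ENNReal.toReal_pos (Metric.measure_ball_pos _ _ one_pos).ne' measure_ball_lt_top.ne

/-- The rigid motion is built from one size chosen for the set `Q`, while the estimate is asked for
any size presented with `Q`. Comparing inscribed and circumscribed balls shows that two such sizes
are comparable, which is enough. -/
lemma IsCubeOrBall.le_mul (hn : 1 ≤ n) {Q : Set (EuclideanSpace ℝ (Fin n))} {l l' : ℝ}
    (h : IsCubeOrBall Q l) (h' : IsCubeOrBall Q l') : l ≤ 2 * n * l' := by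
  obtain ⟨z, hz, -⟩ := h.exists_center hn
  obtain ⟨z', -, hz'⟩ := h'.exists_center hn
  have h1 := measureReal_mono (μ := volume) (hz.trans hz') measure_ball_lt_top.ne
  have hl := h.1
  have hl' := h'.1
  have hn' : (1 : ℝ) ≤ n := by exact_mod_cast hn
  rw [volume_real_ball z (by positivity), volume_real_ball z' (by positivity)] at h1
  have h2 := le_of_mul_le_mul_right h1 volume_real_unitBall_pos
  have h3 := (pow_le_pow_iff_left₀ (by positivity) (by positivity) (by omega : n ≠ 0)).1 h2
  linarith

lemma IsCubeOrBall.volume_le (hn : 1 ≤ n) {Q : Set (EuclideanSpace ℝ (Fin n))} {l : ℝ}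
    (h : IsCubeOrBall Q l) :
    volume Q ≤ ENNReal.ofReal ((n * l) ^ n *
      volume.real (Metric.ball (0 : EuclideanSpace ℝ (Fin n)) 1)) := by
  obtain ⟨z, -, hz⟩ := h.exists_center hn
  have hl := h.1
  refine (measure_mono hz).trans (le_of_eq ?_)
  rw [← ofReal_measureReal (measure_ball_lt_top.ne),
    volume_real_ball z (by positivity)]

lemma IsCubeOrBall.le_volume (hn : 1 ≤ n) {Q : Set (EuclideanSpace ℝ (Fin n))} {l : ℝ}
    (h : IsCubeOrBall Q l) :
    ENNReal.ofReal ((l / 2) ^ n *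
      volume.real (Metric.ball (0 : EuclideanSpace ℝ (Fin n)) 1)) ≤ volume Q := by
  obtain ⟨z, hz, -⟩ := h.exists_center hn
  have hl := h.1
  refine le_trans (le_of_eq ?_) (measure_mono hz)
  rw [← ofReal_measureReal (measure_ball_lt_top.ne) (s := Metric.ball z (l / 2)),
    volume_real_ball z (by positivity)]

/-! ### The weight, the rigid motion and the pointwise bound -/

/-- Weights of unit mass near the centre, with the natural scaling of the derivatives. -/
lemma exists_weight (n : ℕ) : ∃ C₀ : ℝ, 0 ≤ C₀ ∧ ∀ (z : EuclideanSpace ℝ (Fin n)) (l : ℝ), 0 < l →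
    ∃ η : EuclideanSpace ℝ (Fin n) → ℝ, ContDiff ℝ ∞ η ∧ HasCompactSupport η ∧
      ∫ y, η y = 1 ∧ tsupport η ⊆ Metric.closedBall z (l / 4) ∧
      (∀ y, |η y| ≤ C₀ * (l ^ n)⁻¹) ∧
      ∀ y v, |fderiv ℝ η y v| ≤ C₀ * (l ^ n)⁻¹ * l⁻¹ * ‖v‖ := by
  -- After dilation by `l`, the outer radius `1/4` keeps the support strictly inside the ball of
  -- radius `l / 2` that every cube or ball of size `l` contains.
  let b : ContDiffBump (0 : EuclideanSpace ℝ (Fin n)) := ⟨1 / 8, 1 / 4, by norm_num, by norm_num⟩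
  set χ := b.normed volume with hχ
  have hs : ContDiff ℝ ∞ χ := b.contDiff_normed
  have hc : HasCompactSupport χ := b.hasCompactSupport_normed
  obtain ⟨A, hA⟩ := hc.exists_bound_of_continuous hs.continuous
  obtain ⟨B, hB⟩ := (hc.fderiv ℝ).exists_bound_of_continuous
    (hs.fderiv_right (m := ∞) (by simp)).continuous
  have hA0 : 0 ≤ A := (norm_nonneg _).trans (hA 0)
  refine ⟨max A B, hA0.trans (le_max_left _ _), fun z l hl => ⟨dilate l z χ, contDiff_dilate hs l z,
    ?_⟩⟩
  have hsupp : Function.support (dilate l z χ) ⊆ Metric.closedBall z (l / 4) := by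
    intro y hy
    have h1 : l⁻¹ • (y - z) ∈ tsupport χ := subset_tsupport _ fun h => hy (by simp [dilate, h])
    rw [b.tsupport_normed_eq, mem_closedBall_zero_iff, norm_smul, norm_inv,
      Real.norm_of_nonneg hl.le, inv_mul_le_iff₀ hl] at h1
    rw [Metric.mem_closedBall, dist_eq_norm]
    exact h1.trans (le_of_eq (by simp only [b]; ring))
  refine ⟨HasCompactSupport.of_support_subset_isCompact (isCompact_closedBall _ _) hsupp, ?_,
    closure_minimal hsupp Metric.isClosed_closedBall, fun y => ?_, fun y v => ?_⟩
  · rw [integral_dilate _ hl]; exact b.integral_normed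
  · rw [dilate, abs_mul, abs_of_pos (by positivity : 0 < (l ^ n)⁻¹), mul_comm]
    gcongr
    exact (hA _).trans (le_max_left _ _)
  · rw [fderiv_dilate (hs.differentiable (by simp)), dilate, abs_mul, abs_mul,
      abs_of_pos (by positivity : 0 < (l ^ n)⁻¹), abs_of_pos (by positivity : 0 < l⁻¹)]
    have h1 : |fderiv ℝ χ (l⁻¹ • (y - z)) v| ≤ max A B * ‖v‖ :=
      ((fderiv ℝ χ _).le_opNorm v).trans (by gcongr; exact (hB _).trans (le_max_right _ _))
    calc _ ≤ l⁻¹ * ((l ^ n)⁻¹ * (max A B * ‖v‖)) := by gcongr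
      _ = _ := by ring

/-- On the support `|ζ| ≤ 2 n l`, and each derivative of `η` costs `1/l`, so the kernel has size `l
^ (1 - n)`. The constant is `10 = 6 + 4`, from the divergence term and the quadratic term. -/
lemma abs_strainKernel_le (hn : 1 ≤ n) {η : EuclideanSpace ℝ (Fin n) → ℝ}
    {z x : EuclideanSpace ℝ (Fin n)}
    {C₀ l : ℝ} (hl : 0 < l) (hC₀ : 0 ≤ C₀)
    (hsupp : tsupport η ⊆ Metric.closedBall z (l / 4)) (hb : ∀ y, |η y| ≤ C₀ * (l ^ n)⁻¹)
    (hb' : ∀ y v, |fderiv ℝ η y v| ≤ C₀ * (l ^ n)⁻¹ * l⁻¹ * ‖v‖)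
    (hx : x ∈ Metric.ball z (n * l)) (i j k : Fin n) (ζ : EuclideanSpace ℝ (Fin n)) :
    |strainKernel (fun ζ => η (x + ζ)) i j k ζ| ≤ 10 * n ^ 2 * C₀ * (l * (l ^ n)⁻¹) := by
  have hn' : (1 : ℝ) ≤ n := by exact_mod_cast hn
  have hR : 0 ≤ 10 * n ^ 2 * C₀ * (l * (l ^ n)⁻¹) := by positivity
  by_cases hζ : ζ ∈ tsupport (fun ζ => η (x + ζ))
  swap
  · have : strainKernel (fun ζ => η (x + ζ)) i j k ζ = 0 := image_eq_zero_of_notMem_tsupport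
      fun h => hζ (tsupport_strainKernel_subset _ i j k h)
    rwa [this, abs_zero]
  have h1 := hsupp (tsupport_comp_subset_preimage η (f := fun ζ => x + ζ) (by fun_prop) hζ)
  rw [Metric.mem_closedBall, dist_eq_norm] at h1
  rw [Metric.mem_ball, dist_eq_norm] at hx
  have hζn : ‖ζ‖ ≤ 2 * n * l := by
    have : ζ = (x + ζ - z) - (x - z) := by abel
    rw [this]
    refine (norm_sub_le _ _).trans ?_
    nlinarith
  have hcoord : ∀ m, |ζ m| ≤ 2 * n * l := fun m => (PiLp.norm_apply_le ζ m).trans hζn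
  set D := C₀ * (l ^ n)⁻¹ with hD
  have hD0 : 0 ≤ D := by positivity
  have hfd : fderiv ℝ (fun ζ => η (x + ζ)) ζ = fderiv ℝ η (x + ζ) := fderiv_comp_add_left x
  have hdiv : |divRadial (fun ζ => η (x + ζ)) ζ| ≤ 3 * n * D := by
    rw [divRadial, hfd]
    calc _ ≤ |n * η (x + ζ)| + |fderiv ℝ η (x + ζ) ζ| := abs_add_le _ _
      _ ≤ n * D + D * l⁻¹ * (2 * n * l) := by
        rw [abs_mul, Nat.abs_cast]
        gcongr
        · exact hb _
        · exact (hb' _ _).trans (by gcongr)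
      _ = 3 * n * D := by field_simp; ring
  have hpd : |fderiv ℝ (fun ζ => η (x + ζ)) ζ (EuclideanSpace.single i 1)| ≤ D * l⁻¹ := by
    rw [hfd]
    simpa using hb' (x + ζ) (EuclideanSpace.single i 1)
  have hite : ∀ (q : Prop) [Decidable q] (m : Fin n), |if q then ζ m else 0| ≤ 2 * n * l := by
    intro q _ m
    split_ifs
    · exact hcoord m
    · rw [abs_zero]; positivity
  have h2 : |((if j = i then ζ k else 0) + (if k = i then ζ j else 0)) *
      divRadial (fun ζ => η (x + ζ)) ζ| ≤ (2 * n * l + 2 * n * l) * (3 * n * D) := by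
    rw [abs_mul]
    exact mul_le_mul ((abs_add_le _ _).trans (add_le_add (hite _ _) (hite _ _))) hdiv
      (abs_nonneg _) (by positivity)
  have h3 : |ζ j * ζ k * fderiv ℝ (fun ζ => η (x + ζ)) ζ (EuclideanSpace.single i 1)| ≤
      (2 * n * l) * (2 * n * l) * (D * l⁻¹) := by
    rw [abs_mul, abs_mul]
    gcongr
    · exact hcoord j
    · exact hcoord k
  rw [strainKernel]
  calc _ ≤ |(1 / 2) * (((if j = i then ζ k else 0) + (if k = i then ζ j else 0)) *
          divRadial (fun ζ => η (x + ζ)) ζ)| +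
        |ζ j * ζ k * fderiv ℝ (fun ζ => η (x + ζ)) ζ (EuclideanSpace.single i 1)| := abs_sub _ _
    _ ≤ (1 / 2) * ((2 * n * l + 2 * n * l) * (3 * n * D)) +
        (2 * n * l) * (2 * n * l) * (D * l⁻¹) := by
        rw [abs_mul (1 / 2 : ℝ), abs_of_pos (by norm_num : (0 : ℝ) < 1 / 2)]
        gcongr
    _ = _ := by rw [hD]; field_simp; ring

/-- The averaged rigid motion is a rigid motion. -/
lemma exists_rigidMotion_eq_averagedMotion {Q : Set (EuclideanSpace ℝ (Fin n))}
    {u : EuclideanSpace ℝ (Fin n) → EuclideanSpace ℝ (Fin n)}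
    (hu : ∀ l, IntegrableOn (fun y => u y l) Q)
    {η : EuclideanSpace ℝ (Fin n) → ℝ} (hη : ContDiff ℝ ∞ η) (hc : HasCompactSupport η) :
    ∃ R, IsRigidMotion R ∧ ∀ x i, R x i = averagedMotion Q η u x i 1 := by
  -- With `ζ = y - x` the kernel is affine in `x`. For weakly differentiable `u`, `I l j` is minus
  -- the `η`-average of `∂_j u_l`, so `A` is the skew part of the averaged gradient.
  set I : Fin n → Fin n → ℝ := fun l j =>
    ∫ y in Q, u y l * fderiv ℝ η y (EuclideanSpace.single j 1) with hI
  set A : Matrix (Fin n) (Fin n) ℝ := Matrix.of fun i j => (1 / 2) * (I j i - I i j) with hA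
  set b : EuclideanSpace ℝ (Fin n) := WithLp.toLp 2 fun i =>
    (1 / 2) * ((∫ y in Q, u y i * η y) + ∫ y in Q, u y i * divRadial η y) -
      (1 / 2) * ∑ l, ∫ y in Q, u y l * (y l * fderiv ℝ η y (EuclideanSpace.single i 1)) with hb
  refine ⟨fun x => WithLp.toLp 2 (A.mulVec x.ofLp) + b, ⟨A, b, ?_, fun x => rfl⟩, fun x i => ?_⟩
  · ext i j
    simp [hA]
    ring
  have hcf : ∀ j, HasCompactSupport fun y => fderiv ℝ η y (EuclideanSpace.single j 1) :=
    fun j => hc.fderiv_apply ℝ _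
  have hi1 : ∀ l, IntegrableOn (fun y => u y l * η y) Q := fun l =>
    integrable_mul_of_hasCompactSupport (hu l) hη.continuous hc
  have hi2 : ∀ l, IntegrableOn (fun y => u y l * divRadial η y) Q := fun l =>
    integrable_mul_of_hasCompactSupport (hu l) (contDiff_divRadial hη).continuous
      (hasCompactSupport_divRadial hc)
  have hi3 : ∀ l j, IntegrableOn
      (fun y => u y l * fderiv ℝ η y (EuclideanSpace.single j 1)) Q := fun l j =>
    integrable_mul_of_hasCompactSupport (hu l) (contDiff_fderiv_apply hη _).continuous (hcf j)
  have hi4 : ∀ l j, IntegrableOn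
      (fun y => u y l * (y l * fderiv ℝ η y (EuclideanSpace.single j 1))) Q := fun l j =>
    integrable_mul_of_hasCompactSupport (hu l)
      ((contDiff_apply_coord l).continuous.mul (contDiff_fderiv_apply hη _).continuous)
      (hcf j).mul_left
  have hfd : ∀ ζ, fderiv ℝ (fun ζ => η (x + ζ)) ζ = fderiv ℝ η (x + ζ) :=
    fun ζ => fderiv_comp_add_left x
  have hpt : ∀ l y, u y l * dilate 1 x (motionKernel (fun ζ => η (x + ζ)) i l) y =
      (if l = i then (1 / 2) * (u y l * η y) + (1 / 2) * (u y l * divRadial η y) -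
        ∑ j, ((1 / 2) * x j) * (u y l * fderiv ℝ η y (EuclideanSpace.single j 1)) else 0) -
      ((1 / 2) * (u y l * (y l * fderiv ℝ η y (EuclideanSpace.single i 1))) -
        (1 / 2 * x l) * (u y l * fderiv ℝ η y (EuclideanSpace.single i 1))) := by
    intro l y
    have hs : ∑ j, ((1 / 2) * x j) * (u y l * fderiv ℝ η y (EuclideanSpace.single j 1)) =
        (1 / 2) * u y l * fderiv ℝ η y x := by
      rw [← sum_coord_mul, Finset.mul_sum]
      exact Finset.sum_congr rfl fun j _ => by ring
    rw [hs]
    simp only [dilate, motionKernel, divRadial, hfd, one_pow, inv_one, one_smul, one_mul,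
      add_sub_cancel, map_sub, PiLp.sub_apply]
    split_ifs <;> ring
  have hi5 : ∀ l, Integrable (fun y =>
      (1 / 2) * (u y l * η y) + (1 / 2) * (u y l * divRadial η y) -
        ∑ j, ((1 / 2) * x j) * (u y l * fderiv ℝ η y (EuclideanSpace.single j 1)))
      (volume.restrict Q) := fun l =>
    (((hi1 l).const_mul _).add ((hi2 l).const_mul _)).sub
      (integrable_finsetSum _ fun j _ => (hi3 l j).const_mul _)
  have hi6 : ∀ l, Integrable (fun y =>
      (1 / 2) * (u y l * (y l * fderiv ℝ η y (EuclideanSpace.single i 1))) -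
        (1 / 2 * x l) * (u y l * fderiv ℝ η y (EuclideanSpace.single i 1)))
      (volume.restrict Q) := fun l => ((hi4 l i).const_mul _).sub ((hi3 l i).const_mul _)
  have hint : ∀ l, ∫ y in Q, u y l * dilate 1 x (motionKernel (fun ζ => η (x + ζ)) i l) y =
      (if l = i then (1 / 2) * (∫ y in Q, u y l * η y) +
        (1 / 2) * (∫ y in Q, u y l * divRadial η y) - ∑ j, ((1 / 2) * x j) * I l j else 0) -
      ((1 / 2) * (∫ y in Q, u y l * (y l * fderiv ℝ η y (EuclideanSpace.single i 1))) -
        (1 / 2 * x l) * I l i) := by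
    intro l
    simp_rw [hpt]
    have h6 : ∫ y in Q, ((1 / 2) * (u y l * (y l * fderiv ℝ η y (EuclideanSpace.single i 1))) -
        (1 / 2 * x l) * (u y l * fderiv ℝ η y (EuclideanSpace.single i 1))) =
        (1 / 2) * (∫ y in Q, u y l * (y l * fderiv ℝ η y (EuclideanSpace.single i 1))) -
        (1 / 2 * x l) * I l i := by
      rw [integral_sub ((hi4 l i).const_mul _) ((hi3 l i).const_mul _), integral_const_mul,
        integral_const_mul]
    split_ifs with h
    · rw [integral_sub (hi5 l) (hi6 l), h6]
      congr 1
      have hi12 : Integrable (fun y => (1 / 2) * (u y l * η y) + (1 / 2) * (u y l * divRadial η y))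
        (volume.restrict Q) := ((hi1 l).const_mul _).add ((hi2 l).const_mul _)
      rw [integral_sub hi12
        (integrable_finsetSum _ fun j _ => (hi3 l j).const_mul _),
        integral_add ((hi1 l).const_mul _) ((hi2 l).const_mul _), integral_const_mul,
        integral_const_mul, integral_finsetSum _ fun j _ => (hi3 l j).const_mul _]
      simp_rw [integral_const_mul]
      rfl
    · simp_rw [zero_sub]
      rw [integral_neg, h6]
  simp only [averagedMotion, hint, Finset.sum_sub_distrib, Finset.sum_ite_eq', Finset.mem_univ,
    if_true, ← Finset.mul_sum]
  have hAx : A.mulVec x.ofLp i = ∑ l, (1 / 2 * x l) * I l i - ∑ j, ((1 / 2) * x j) * I i j := by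
    rw [← Finset.sum_sub_distrib]
    simp only [Matrix.mulVec, dotProduct, hA, Matrix.of_apply]
    exact Finset.sum_congr rfl fun j _ => by ring
  simp only [PiLp.add_apply, hAx, hb]
  ring

lemma enorm_le_sum_coord (v : EuclideanSpace ℝ (Fin n)) : ‖v‖ₑ ≤ ∑ i, ‖v i‖ₑ := by
  have h : v = ∑ m, v m • EuclideanSpace.single m (1 : ℝ) := by
    ext j
    simp [Finset.sum_apply, Pi.single_apply]
  conv_lhs => rw [h]
  refine (enorm_sum_le _ _).trans (le_of_eq (Finset.sum_congr rfl fun i _ => ?_))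
  rw [enorm_smul]
  have : ‖EuclideanSpace.single i (1 : ℝ)‖ₑ = 1 := by
    rw [← ofReal_norm]; simp
  rw [this, mul_one]

lemma IsCubeOrBall.volume_ne_zero (hn : 1 ≤ n) {Q : Set (EuclideanSpace ℝ (Fin n))} {l : ℝ}
    (h : IsCubeOrBall Q l) : volume Q ≠ 0 := by
  have hl := h.1
  have hv := volume_real_unitBall_pos (n := n)
  refine (lt_of_lt_of_le ?_ (h.le_volume hn)).ne'
  rw [ENNReal.ofReal_pos]
  positivity

lemma IsCubeOrBall.volume_ne_top (hn : 1 ≤ n) {Q : Set (EuclideanSpace ℝ (Fin n))} {l : ℝ}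
    (h : IsCubeOrBall Q l) : volume Q ≠ ⊤ :=
  ne_top_of_le_ne_top ENNReal.ofReal_ne_top (h.volume_le hn)

/-- The normalised Lebesgue measure on `Q`. -/
noncomputable def averageMeasure (Q : Set (EuclideanSpace ℝ (Fin n))) :
    Measure (EuclideanSpace ℝ (Fin n)) := (volume Q)⁻¹ • volume.restrict Q

lemma lintegral_averageMeasure (Q : Set (EuclideanSpace ℝ (Fin n)))
    (f : EuclideanSpace ℝ (Fin n) → ℝ≥0∞) :
    ∫⁻ y, f y ∂averageMeasure Q = (volume Q)⁻¹ * ∫⁻ y in Q, f y := by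
  rw [averageMeasure, lintegral_smul_measure, smul_eq_mul]

lemma setLIntegral_eq_mul_averageMeasure (hn : 1 ≤ n) {Q : Set (EuclideanSpace ℝ (Fin n))} {l : ℝ}
    (h : IsCubeOrBall Q l) (f : EuclideanSpace ℝ (Fin n) → ℝ≥0∞) :
    ∫⁻ y in Q, f y = volume Q * ∫⁻ y, f y ∂averageMeasure Q := by
  rw [lintegral_averageMeasure, ← mul_assoc,
    ENNReal.mul_inv_cancel (h.volume_ne_zero hn) (h.volume_ne_top hn), one_mul]

/-- The order of quantifiers matters: the rigid motion is fixed by `Q` and `u` before the size, the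
weak gradient and the majorant `f` enter. -/
lemma exists_rigidMotion_pointwise (hn : 1 ≤ n) : ∃ C : ℝ, 1 ≤ C ∧
    ∀ Q : Set (EuclideanSpace ℝ (Fin n)), (∃ l, IsCubeOrBall Q l) →
    ∀ u : EuclideanSpace ℝ (Fin n) → EuclideanSpace ℝ (Fin n),
    (∀ i, IntegrableOn (fun y => u y i) Q) →
    ∃ R, IsRigidMotion R ∧ ∀ (l : ℝ), IsCubeOrBall Q l →
      ∀ (G : EuclideanSpace ℝ (Fin n) → Matrix (Fin n) (Fin n) ℝ)
        (f : EuclideanSpace ℝ (Fin n) → ℝ),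
      (∀ i j, IntegrableOn (fun y => G y i j) Q) →
      (∀ i j, IsWeakPartialDeriv Q j (fun y => u y i) (fun y => G y i j)) →
      (∀ y, 0 ≤ f y) → (∀ᵐ y ∂(volume.restrict Q), matNorm (symPart (G y)) ≤ f y) →
      ∀ᵐ x ∂(volume.restrict Q), ‖u x - R x‖ₑ ≤ ENNReal.ofReal (C * l) *
        ∫⁻ s in Set.Ioc (0 : ℝ) 1,
          ∫⁻ y, ENNReal.ofReal (f (x + s • (y - x))) ∂averageMeasure Q := by
  obtain ⟨C₀, hC₀, hw⟩ := exists_weight n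
  set v := volume.real (Metric.ball (0 : EuclideanSpace ℝ (Fin n)) 1) with hv
  have hv0 : 0 < v := volume_real_unitBall_pos
  have hn' : (1 : ℝ) ≤ n := by exact_mod_cast hn
  -- The factors come from the `n` coordinates of `u`, the `n ^ 2` entries of `Du`, the bound of the
  -- strain kernel, the volume of `Q`, and the ratio `2 * n` of two admissible sizes; the final `1`
  -- gives `1 ≤ C`.
  refine ⟨n * (n ^ 2 * (10 * n ^ 2 * C₀) * n ^ n * v) * (2 * n) + 1,
    le_add_of_nonneg_left (by positivity), ?_⟩
  rintro Q ⟨l₀, hl₀⟩ u hu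
  obtain ⟨z, hz1, hz2⟩ := hl₀.exists_center hn
  have hl₀p := hl₀.1
  obtain ⟨η, hη, hηc, hη1, hηs, hηb, hηb'⟩ := hw z l₀ hl₀p
  have hηQ : tsupport η ⊆ Q :=
    hηs.trans ((Metric.closedBall_subset_ball (by linarith)).trans hz1)
  obtain ⟨R, hR, hRe⟩ := exists_rigidMotion_eq_averagedMotion hu hη hηc
  refine ⟨R, hR, fun l hl G f hG hGw hf0 hfG => ?_⟩
  have hQm := hl₀.isOpen.measurableSet
  -- The null set must not depend on `R`: one Lebesgue point theorem serves all families of balls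
  -- centred at `x` whose radii tend to zero.
  have hleb : ∀ᵐ x ∂(volume : Measure (EuclideanSpace ℝ (Fin n))), ∀ k, ∀ R : ℝ, 0 < R →
      Tendsto (fun s : ℝ => ⨍ y in Metric.closedBall x (s * R),
        ‖Q.indicator (fun y => u y k) y - Q.indicator (fun y => u y k) x‖) (𝓝[>] 0) (𝓝 0) := by
    rw [ae_all_iff]
    intro k
    have hloc : LocallyIntegrable (Q.indicator (fun y => u y k)) volume :=
      ((hu k).integrable_indicator hQm).locallyIntegrable
    filter_upwards [IsUnifLocDoublingMeasure.ae_tendsto_average_norm_sub volume hloc 1]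
      with x hx R hR
    refine hx (fun _ => x) (fun s => s * R) ?_ ?_
    · rw [tendsto_nhdsWithin_iff]
      refine ⟨?_, ?_⟩
      · have : Tendsto (fun s : ℝ => s * R) (𝓝 0) (𝓝 (0 * R)) := tendsto_id.mul_const R
        rw [zero_mul] at this
        exact this.mono_left nhdsWithin_le_nhds
      · filter_upwards [self_mem_nhdsWithin] with s hs using mul_pos hs hR
    · filter_upwards [self_mem_nhdsWithin] with s hs
      have : 0 < s * R := mul_pos hs hR
      simp [this.le]
  filter_upwards [ae_restrict_of_ae hleb, ae_restrict_mem hQm] with x hx hxQ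
  set J := ∫⁻ s in Set.Ioc (0 : ℝ) 1,
    ∫⁻ y, ENNReal.ofReal (f (x + s • (y - x))) ∂averageMeasure Q with hJ
  have hcoord : ∀ i, ‖u x i - R x i‖ₑ ≤
      ENNReal.ofReal ((n ^ 2 * (10 * n ^ 2 * C₀) * n ^ n * v) * l₀) * J := by
    intro i
    rw [hRe]
    refine (abs_sub_averagedMotion_le hl₀.convex hQm hu hG hGw hη hηc hη1 hηQ hxQ hx i
      (fun j k ζ => abs_strainKernel_le hn hl₀p hC₀ hηs hηb hηb' (hz2 hxQ) i j k ζ) hf0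
      hfG).trans ?_
    simp_rw [setLIntegral_eq_mul_averageMeasure hn hl₀]
    rw [lintegral_const_mul' _ _ (hl₀.volume_ne_top hn), ← mul_assoc]
    gcongr
    calc _ ≤ ENNReal.ofReal (n ^ 2 * (10 * n ^ 2 * C₀ * (l₀ * (l₀ ^ n)⁻¹))) *
          ENNReal.ofReal ((n * l₀) ^ n * v) := by
          gcongr
          exact hl₀.volume_le hn
      _ = _ := by
          rw [← ENNReal.ofReal_mul (by positivity)]
          congr 1
          rw [mul_pow]
          field_simp
  calc ‖u x - R x‖ₑ ≤ ∑ i, ‖(u x - R x) i‖ₑ := enorm_le_sum_coord _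
    _ ≤ ∑ _i : Fin n, ENNReal.ofReal ((n ^ 2 * (10 * n ^ 2 * C₀) * n ^ n * v) * l₀) * J :=
        Finset.sum_le_sum fun i _ => hcoord i
    _ = ENNReal.ofReal (n * ((n ^ 2 * (10 * n ^ 2 * C₀) * n ^ n * v) * l₀)) * J := by
        rw [Finset.sum_const, Finset.card_univ, Fintype.card_fin, nsmul_eq_mul,
          ENNReal.ofReal_mul (p := (n : ℝ)) (by positivity), ENNReal.ofReal_natCast,
          mul_assoc (n : ℝ≥0∞)]
    _ ≤ _ := by
        gcongr ENNReal.ofReal ?_ * J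
        have h1 := hl₀.le_mul hn hl
        have hlp := hl.1
        calc n * ((n ^ 2 * (10 * n ^ 2 * C₀) * n ^ n * v) * l₀) ≤
            n * ((n ^ 2 * (10 * n ^ 2 * C₀) * n ^ n * v) * (2 * n * l)) := by gcongr
          _ ≤ _ := by nlinarith

/-! ### Integrability, measurability and double integrals along homotheties -/

lemma matNorm_nonneg (A : Matrix (Fin n) (Fin n) ℝ) : 0 ≤ matNorm A := Real.sqrt_nonneg _

lemma matNorm_le_sum (A : Matrix (Fin n) (Fin n) ℝ) : matNorm A ≤ ∑ i, ∑ j, |A i j| := by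
  have h : ∑ i, ∑ j, A i j ^ 2 ≤ (∑ i, ∑ j, |A i j|) ^ 2 := by
    calc ∑ i, ∑ j, A i j ^ 2 ≤ ∑ i, (∑ j, |A i j|) ^ 2 := by
          refine Finset.sum_le_sum fun i _ => ?_
          simp_rw [← sq_abs (A i _)]
          exact Finset.sum_sq_le_sq_sum_of_nonneg fun j _ => abs_nonneg _
      _ ≤ _ := Finset.sum_sq_le_sq_sum_of_nonneg fun i _ =>
          Finset.sum_nonneg fun j _ => abs_nonneg _
  exact Real.sqrt_le_iff.2 ⟨Finset.sum_nonneg fun i _ => Finset.sum_nonneg fun j _ =>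
    abs_nonneg _, h⟩

/-- On a set of finite measure `t ≤ 1 + t ^ p(x)` suffices, because `p ≥ 1`. -/
lemma MemVarLp.integrableOn {p : EuclideanSpace ℝ (Fin n) → ℝ≥0∞}
    (hp : ∀ x, 1 ≤ (p x).toReal) {Q : Set (EuclideanSpace ℝ (Fin n))} (hQ : volume Q ≠ ⊤)
    {f : EuclideanSpace ℝ (Fin n) → ℝ} (hf : MemVarLp p Q f) : IntegrableOn f Q := by
  obtain ⟨hfm, hfn⟩ := hf
  simp only [luxemburgNorm, iInf_lt_iff] at hfn
  obtain ⟨s, hs, hs1, -⟩ := hfn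
  refine ⟨hfm.aestronglyMeasurable, ?_⟩
  have hpt : ∀ x, ‖f x‖ₑ ≤
      ENNReal.ofReal s * (1 + ENNReal.ofReal (phi p x |f x / s|)) := by
    intro x
    have ht : 0 ≤ |f x / s| := abs_nonneg _
    have hle : |f x / s| ≤ 1 + phi p x |f x / s| := by
      have h0 : 0 ≤ phi p x |f x / s| := by unfold phi; positivity
      rcases le_total |f x / s| 1 with h | h
      · linarith
      · have := Real.rpow_le_rpow_of_exponent_le h (hp x)
        rw [Real.rpow_one] at this
        unfold phi
        linarith
    rw [← ENNReal.ofReal_one, ← ENNReal.ofReal_add zero_le_one (by unfold phi; positivity),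
      ← ENNReal.ofReal_mul hs.le, Real.enorm_eq_ofReal_abs]
    apply ENNReal.ofReal_le_ofReal
    have : |f x| = s * |f x / s| := by
      rw [abs_div, abs_of_pos hs]; field_simp
    rw [this]
    gcongr
  refine lt_of_le_of_lt (lintegral_mono hpt) ?_
  rw [lintegral_const_mul' _ _ ENNReal.ofReal_ne_top, lintegral_add_left measurable_const]
  refine ENNReal.mul_lt_top ENNReal.ofReal_lt_top (ENNReal.add_lt_top.2 ⟨?_, ?_⟩)
  · simpa using hQ.lt_top
  · exact hs1.trans_lt ENNReal.one_lt_top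

lemma measurable_shiftPow {a : ℝ} {α : Type*} [MeasurableSpace α] {q t : α → ℝ} (hq : Measurable q)
    (ht : Measurable t) : Measurable fun y => shiftPow a (q y) (t y) := by
  unfold shiftPow shiftSlope
  exact (((measurable_const.add ht).pow (hq.sub_const 1)).mul
    (ht.div (measurable_const.add ht))).mul ht

lemma setLIntegral_homothety_le {Q : Set (EuclideanSpace ℝ (Fin n))} (hQ : Convex ℝ Q)
    (hQm : MeasurableSet Q) {x : EuclideanSpace ℝ (Fin n)} (hx : x ∈ Q) {s : ℝ} (hs : 0 < s)
    (hs1 : s ≤ 1) (g : EuclideanSpace ℝ (Fin n) → ℝ≥0∞) :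
    ∫⁻ y in Q, g (x + s • (y - x)) ≤ ENNReal.ofReal (s ^ n)⁻¹ * ∫⁻ y in Q, g y := by
  calc ∫⁻ y in Q, g (x + s • (y - x)) ≤ ∫⁻ y in Q, Q.indicator g (x + s • (y - x)) := by
        refine setLIntegral_mono' hQm fun y hy => ?_
        rw [Set.indicator_of_mem (add_smul_mem_of_convex hQ hx hy hs.le hs1)]
    _ ≤ ∫⁻ y, Q.indicator g (x + s • (y - x)) := setLIntegral_le_lintegral _ _
    _ = _ := by rw [lintegral_homothety _ hs, lintegral_indicator hQm]

/-- The plain substitution in `y` costs `s ^ (-n)`, which is too much for small `s`. For `s ≤ 1/2`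
the roles of `x` and `y` are exchanged: `x + s (y - x) = y + (1 - s) (x - y)`, and the ratio is at
least `1/2` again. -/
lemma setLIntegral_setLIntegral_homothety_le {Q : Set (EuclideanSpace ℝ (Fin n))}
    (hQ : Convex ℝ Q) (hQm : MeasurableSet Q) {s : ℝ} (hs : 0 < s) (hs1 : s ≤ 1)
    {g : EuclideanSpace ℝ (Fin n) → ℝ≥0∞} (hg : Measurable g) :
    ∫⁻ x in Q, ∫⁻ y in Q, g (x + s • (y - x)) ≤
      ENNReal.ofReal (2 ^ n) * ((∫⁻ y in Q, g y) * volume Q) := by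
  have key : ∀ t : ℝ, 1 / 2 ≤ t → t ≤ 1 → ∫⁻ x in Q, ∫⁻ y in Q, g (x + t • (y - x)) ≤
      ENNReal.ofReal (2 ^ n) * ((∫⁻ y in Q, g y) * volume Q) := by
    intro t ht ht1
    have ht0 : 0 < t := by linarith
    calc _ ≤ ∫⁻ _ in Q, ENNReal.ofReal (2 ^ n) * ∫⁻ y in Q, g y := by
          refine setLIntegral_mono' hQm fun x hx => ?_
          refine (setLIntegral_homothety_le hQ hQm hx ht0 ht1 g).trans ?_
          gcongr
          rw [← inv_pow]
          gcongr
          rw [inv_le_comm₀ ht0 two_pos]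
          linarith
      _ = _ := by rw [setLIntegral_const, mul_assoc]
  rcases le_total (1 / 2) s with h | h
  · exact key s h hs1
  · rw [lintegral_lintegral_swap]
    · refine le_trans (le_of_eq ?_) (key (1 - s) (by linarith) (by linarith))
      refine lintegral_congr fun y => lintegral_congr fun x => ?_
      congr 1
      module
    · exact (hg.comp (by fun_prop)).aemeasurable

/-! ### The modular estimate -/

/-- Both `s⁻¹` and `l⁻¹` are at most `1 / (s l)`, so the bound on the averages becomes a power of
the quantity whose logarithm controls the oscillation of the exponent. The exponent is `n` from `s ^
(-n)` plus `n m` from `V ^ (-m)`. -/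
lemma inv_pow_mul_rpow_neg_le {l m s V c₁ : ℝ} (hn : 1 ≤ n) (hm : 0 < m) (hl : 0 < l) (hl1 : l ≤ 1)
    (hs : 0 < s) (hs1 : s ≤ 1) (hc₁ : 0 < c₁) (hV : c₁ * l ^ n ≤ V) :
    (s ^ n)⁻¹ * V ^ (-m) ≤ max 1 (c₁ ^ (-m) * (2 * n) ^ (n * (1 + m))) *
      (Real.exp 1 + 1 / (2 * n * (s * l))) ^ (n * (1 + m)) := by
  have hn0 : (0 : ℝ) < n := by exact_mod_cast hn
  set X : ℝ := Real.exp 1 + 1 / (2 * n * (s * l)) with hX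
  have hX0 : 0 < X := by positivity
  have hV0 : 0 < V := lt_of_lt_of_le (by positivity) hV
  have hsl : 1 / (s * l) ≤ 2 * n * X := by
    have : 1 / (s * l) = 2 * n * (1 / (2 * n * (s * l))) := by field_simp
    rw [this]
    gcongr
    rw [hX]
    linarith [Real.exp_pos 1]
  have hsX : s⁻¹ ≤ 2 * n * X := by
    refine le_trans ?_ hsl
    rw [one_div]
    exact inv_anti₀ (by positivity) (by nlinarith)
  have hlX : l⁻¹ ≤ 2 * n * X := by
    refine le_trans ?_ hsl
    rw [one_div]
    exact inv_anti₀ (by positivity) (by nlinarith)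
  have h1 : V ^ (-m) ≤ c₁ ^ (-m) * (l⁻¹) ^ (n * m) := by
    calc V ^ (-m) ≤ (c₁ * l ^ n) ^ (-m) :=
          Real.rpow_le_rpow_of_nonpos (by positivity) hV (by linarith)
      _ = c₁ ^ (-m) * (l⁻¹) ^ (n * m) := by
          rw [Real.mul_rpow hc₁.le (by positivity), ← Real.rpow_natCast l n,
            ← Real.rpow_mul hl.le, Real.inv_rpow hl.le, ← Real.rpow_neg hl.le]
          congr 2
          ring
  calc (s ^ n)⁻¹ * V ^ (-m) ≤ (2 * n * X) ^ (n : ℝ) * (c₁ ^ (-m) * (2 * n * X) ^ (n * m)) := by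
        refine mul_le_mul ?_ (h1.trans ?_) (by positivity) (by positivity)
        · rw [Real.rpow_natCast, ← inv_pow]
          gcongr
        · gcongr
    _ = c₁ ^ (-m) * (2 * n) ^ (n * (1 + m)) * X ^ (n * (1 + m)) := by
        rw [mul_left_comm, ← Real.rpow_add (by positivity), mul_assoc (c₁ ^ (-m)),
          ← Real.mul_rpow (by positivity) (by positivity)]
        congr 2
        ring
    _ ≤ _ := by
      gcongr
      exact le_max_right _ _

/-- The key estimate for the averages of `f` over the homothetic copies of `Q`. -/
lemma exists_average_estimate (hn : 1 ≤ n) {m : ℝ} (hm : 0 < m) (K P : ℝ≥0) :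
    ∃ B E : ℝ, 0 ≤ B ∧ 0 ≤ E ∧
      ∀ p : EuclideanSpace ℝ (Fin n) → ℝ≥0∞,
        IsLogHolderExponent p → cLog p ≤ (K : ℝ) → pPlus p ≤ (P : ℝ≥0∞) →
      ∀ (Q : Set (EuclideanSpace ℝ (Fin n))) (l : ℝ), IsCubeOrBall Q l → l ≤ 1 →
      ∀ (f : EuclideanSpace ℝ (Fin n) → ℝ), (∀ y, 0 ≤ f y) → IntegrableOn f Q →
      ∀ a : ℝ, 0 ≤ a → a + (⨍ y in Q, f y) ≤ (volume.real Q) ^ (-m) →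
      ∀ x ∈ Q, ∀ s ∈ Set.Ioc (0 : ℝ) 1, ∃ F : ℝ, 0 ≤ F ∧
        ∫⁻ y, ENNReal.ofReal (f (x + s • (y - x))) ∂averageMeasure Q = ENNReal.ofReal F ∧
        ENNReal.ofReal (shiftPow a (p x).toReal (F / 2)) ≤
          ENNReal.ofReal B * (∫⁻ y, ENNReal.ofReal (shiftPow a (p (x + s • (y - x))).toReal
            (f (x + s • (y - x)))) ∂averageMeasure Q) +
          ENNReal.ofReal (E * (volume.real Q) ^ m) := by
  set v := volume.real (Metric.ball (0 : EuclideanSpace ℝ (Fin n)) 1) with hv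
  have hv0 : 0 < v := volume_real_unitBall_pos
  have hn' : (1 : ℝ) ≤ n := by exact_mod_cast hn
  have hn0 : (0 : ℝ) < n := by linarith
  set c₁ : ℝ := v / 2 ^ n with hc₁
  have hc₁0 : 0 < c₁ := by positivity
  set N : ℝ := n * (1 + m) with hN
  set A : ℝ := max 1 (c₁ ^ (-m) * (2 * n) ^ N) with hA
  -- The factor `2` is there because `shiftPow_average_le` needs the bound for `Λ ^ (2 * ε)`.
  set L : ℝ := 2 * (P ^ 2 * (K + 1)) with hL
  set B : ℝ := A ^ L * Real.exp (N * L) with hB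
  -- A bound for the threshold `V ^ m`, uniform over all `Q` with `l ≤ 1`.
  set D : ℝ := max 1 ((n ^ n * v) ^ m) with hD
  have hA1 : 1 ≤ A := le_max_left _ _
  have hD1 : 1 ≤ D := le_max_left _ _
  have hB0 : 0 ≤ B := by positivity
  refine ⟨B ^ 2, B * D ^ (P : ℝ), by positivity, by positivity, ?_⟩
  intro p hp hK hP Q l hQ hl1 f hf0 hfi a ha haf x hx s hs
  have hl := hQ.1
  have hQv0 := hQ.volume_ne_zero hn
  have hQvt := hQ.volume_ne_top hn
  have hQm := hQ.isOpen.measurableSet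
  have : IsProbabilityMeasure (averageMeasure Q) := ⟨by
    rw [averageMeasure, Measure.smul_apply, Measure.restrict_apply_univ, smul_eq_mul,
      ENNReal.inv_mul_cancel hQv0 hQvt]⟩
  set V := volume.real Q with hV
  have hV0 : 0 < V := ENNReal.toReal_pos hQv0 hQvt
  have hVlow : c₁ * l ^ n ≤ V := by
    have h := (ENNReal.ofReal_le_iff_le_toReal hQvt).1 (hQ.le_volume hn)
    refine le_trans (le_of_eq ?_) h
    rw [hc₁, div_pow]
    ring
  have hVup : V ≤ n ^ n * v := by
    have h := ENNReal.toReal_le_of_le_ofReal (by positivity) (hQ.volume_le hn)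
    refine h.trans ?_
    rw [mul_pow]
    have : l ^ n ≤ 1 := pow_le_one₀ hl.le hl1
    have h0 : 0 ≤ (n : ℝ) ^ n * v := by positivity
    nlinarith
  have hs0 := hs.1
  have hs1 := hs.2
  have hav : ∫⁻ y, ENNReal.ofReal (f y) ∂averageMeasure Q = ENNReal.ofReal (⨍ y in Q, f y) := by
    rw [lintegral_averageMeasure, ← ofReal_integral_eq_lintegral_ofReal hfi
      (Eventually.of_forall hf0), setAverage_eq, smul_eq_mul, ENNReal.ofReal_mul (by positivity),
      ENNReal.ofReal_inv_of_pos hV0, hV, ofReal_measureReal hQvt]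
  have hav0 : 0 ≤ ⨍ y in Q, f y := by
    rw [setAverage_eq, smul_eq_mul]
    exact mul_nonneg (by positivity) (integral_nonneg hf0)
  set Ms := ∫⁻ y, ENNReal.ofReal (f (x + s • (y - x))) ∂averageMeasure Q with hMs
  have hMle : Ms ≤ ENNReal.ofReal ((s ^ n)⁻¹ * ⨍ y in Q, f y) := by
    rw [ENNReal.ofReal_mul (by positivity), ← hav, hMs, lintegral_averageMeasure,
      lintegral_averageMeasure, mul_left_comm]
    gcongr
    exact setLIntegral_homothety_le hQ.convex hQm hx hs0 hs1 fun y => ENNReal.ofReal (f y)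
  have hMF : Ms = ENNReal.ofReal Ms.toReal :=
    (ENNReal.ofReal_toReal (ne_top_of_le_ne_top ENNReal.ofReal_ne_top hMle)).symm
  refine ⟨Ms.toReal, ENNReal.toReal_nonneg, hMF, ?_⟩
  have hFle : Ms.toReal ≤ (s ^ n)⁻¹ * ⨍ y in Q, f y :=
    ENNReal.toReal_le_of_le_ofReal (by positivity) hMle
  -- `d` bounds the distance from `x` to the points of the copy of `Q` shrunk by `s` towards `x`.
  set d : ℝ := 2 * n * (s * l) with hd
  have hd0 : 0 < d := by positivity
  set X : ℝ := Real.exp 1 + 1 / d with hX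
  have hXe : Real.exp 1 ≤ X := le_add_of_nonneg_right (by positivity)
  have hX1 : 1 ≤ X := (Real.one_le_exp zero_le_one).trans hXe
  set Λ : ℝ := A * X ^ N with hΛ
  have hN0 : 0 ≤ N := by positivity
  have hΛ1 : 1 ≤ Λ := one_le_mul_of_one_le_of_one_le hA1 (Real.one_le_rpow hX1 hN0)
  have hsn : 1 ≤ (s ^ n)⁻¹ := (one_le_inv₀ (by positivity)).2 (pow_le_one₀ hs0.le hs1)
  have hVΛ : (s ^ n)⁻¹ * V ^ (-m) ≤ Λ :=
    inv_pow_mul_rpow_neg_le hn hm hl hl1 hs0 hs1 hc₁0 hVlow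
  set ε : ℝ := P ^ 2 * (K + 1) / Real.log X with hε
  have hlogX : 0 < Real.log X := Real.log_pos (by linarith [Real.add_one_lt_exp one_ne_zero])
  have hε0 : 0 ≤ ε := by positivity
  obtain ⟨z, -, hzQ⟩ := hQ.exists_center hn
  obtain ⟨-, hp1, hpP⟩ := exponent_bounds hp hP x
  have hδ0 : 0 < V ^ m := by positivity
  have hΛB : Λ ^ (2 * ε) ≤ B := by
    refine rpow_le_of_le_div_log hXe hA1 hN0 (by positivity) (le_of_eq ?_) (by positivity) le_rfl
    rw [hε, hL]; ring
  have hest := shiftPow_average_le (μ := averageMeasure Q) (a := a) (q := (p x).toReal)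
    (F := Ms.toReal) (P := P) (Λ := Λ) (δ := V ^ m) (B := B) (D := D) (ε := ε)
    (f := fun y => f (x + s • (y - x))) (r := fun y => (p (x + s • (y - x))).toReal)
    ha hp1 hpP hε0 (fun y => (exponent_bounds hp hP _).2.1) ?_ ENNReal.toReal_nonneg
    (fun y => hf0 _) hMF.ge ?_ hΛ1 hδ0 ?_ hΛB hD1 ?_
  · exact hest
  · refine Measure.ae_smul_measure ?_ _
    refine (ae_restrict_iff' hQm).2 (Eventually.of_forall fun y hy => ?_)
    refine exponent_abs_sub_le hp hK hP hd0 ?_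
    have h1 := hzQ hy
    have h2 := hzQ hx
    rw [Metric.mem_ball, dist_eq_norm] at h1 h2
    rw [add_sub_cancel_left, norm_smul, Real.norm_of_nonneg hs0.le]
    have h3 : ‖y - x‖ ≤ 2 * n * l := by
      rw [← sub_sub_sub_cancel_right y x z]
      refine (norm_sub_le _ _).trans ?_
      linarith
    calc s * ‖y - x‖ ≤ s * (2 * n * l) := by gcongr
      _ = d := by rw [hd]; ring
  · refine le_trans ?_ hVΛ
    calc a + Ms.toReal ≤ (s ^ n)⁻¹ * a + (s ^ n)⁻¹ * ⨍ y in Q, f y := by nlinarith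
      _ = (s ^ n)⁻¹ * (a + ⨍ y in Q, f y) := by ring
      _ ≤ _ := by gcongr
  · rw [← Real.rpow_neg hV0.le]
    exact (le_mul_of_one_le_left (by positivity) hsn).trans hVΛ
  · exact (Real.rpow_le_rpow hV0.le hVup hm.le).trans (le_max_right _ _)

/-- The modular estimate, from the pointwise bound of `v` by averages of `f`. -/
lemma exists_modular_estimate (hn : 1 ≤ n) {C : ℝ} (hC : 1 ≤ C) {m : ℝ} (hm : 0 < m)
    (K P : ℝ≥0) :
    ∃ c : ℝ, 0 < c ∧
      ∀ p : EuclideanSpace ℝ (Fin n) → ℝ≥0∞,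
        IsLogHolderExponent p → cLog p ≤ (K : ℝ) → pPlus p ≤ (P : ℝ≥0∞) →
      ∀ (Q : Set (EuclideanSpace ℝ (Fin n))) (l : ℝ), IsCubeOrBall Q l → l ≤ 1 →
      ∀ (f : EuclideanSpace ℝ (Fin n) → ℝ), Measurable f → (∀ y, 0 ≤ f y) → IntegrableOn f Q →
      ∀ a : ℝ, 0 ≤ a → a + (⨍ y in Q, f y) ≤ (volume.real Q) ^ (-m) →
      ∀ v : EuclideanSpace ℝ (Fin n) → ℝ, (∀ x, 0 ≤ v x) →
      (∀ᵐ x ∂(volume.restrict Q), ENNReal.ofReal (v x) ≤ ENNReal.ofReal C *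
        ∫⁻ s in Set.Ioc (0 : ℝ) 1,
          ∫⁻ y, ENNReal.ofReal (f (x + s • (y - x))) ∂averageMeasure Q) →
      (∫⁻ x in Q, ENNReal.ofReal (shiftPow a (p x).toReal (v x))) ≤
        ENNReal.ofReal c * (∫⁻ x in Q, ENNReal.ofReal (shiftPow a (p x).toReal (f x))) +
          ENNReal.ofReal (c * (volume.real Q) ^ m) := by
  obtain ⟨B, E, hB, hE, hest⟩ := exists_average_estimate hn hm K P
  set w := volume.real (Metric.ball (0 : EuclideanSpace ℝ (Fin n)) 1) with hw
  have hw0 : 0 < w := volume_real_unitBall_pos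
  have hC0 : 0 < C := by linarith
  -- The dilation constant for `4 * C`: the pointwise bound gives `C`, and each of the two Jensen
  -- substitutes, in `y` and in `s`, halves its argument.
  set T : ℝ := (4 * C) ^ ((P : ℝ) + 1) with hT
  have hT0 : 0 < T := by positivity
  refine ⟨T * (B * 2 ^ n) + T * (E * (n ^ n * w)) + 1, by positivity, ?_⟩
  intro p hp hK hP Q l hQ hl1 f hfm hf0 hfi a ha haf v hv0 hv
  have hl := hQ.1
  have hQv0 := hQ.volume_ne_zero hn
  have hQvt := hQ.volume_ne_top hn
  have hQm := hQ.isOpen.measurableSet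
  set g : EuclideanSpace ℝ (Fin n) → ℝ≥0∞ := fun y =>
    ENNReal.ofReal (shiftPow a (p y).toReal (f y)) with hg
  have hgm : Measurable g := (measurable_shiftPow hp.1.1.ennreal_toReal hfm).ennreal_ofReal
  set V := volume.real Q with hV
  have hVup : volume Q ≤ ENNReal.ofReal (n ^ n * w) := by
    refine (hQ.volume_le hn).trans (ENNReal.ofReal_le_ofReal ?_)
    gcongr
    exact mul_le_of_le_one_right (by positivity) hl1
  have : IsProbabilityMeasure (volume.restrict (Set.Ioc (0 : ℝ) 1)) := ⟨by simp⟩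
  have hpt : ∀ᵐ x ∂(volume.restrict Q), ENNReal.ofReal (shiftPow a (p x).toReal (v x)) ≤
      ENNReal.ofReal T * ∫⁻ s in Set.Ioc (0 : ℝ) 1,
        (ENNReal.ofReal B * (∫⁻ y, g (x + s • (y - x)) ∂averageMeasure Q) +
          ENNReal.ofReal (E * V ^ m)) := by
    filter_upwards [hv, ae_restrict_mem hQm] with x hx hxQ
    obtain ⟨-, hp1, hpP⟩ := exponent_bounds hp hP x
    have hF := hest p hp hK hP Q l hQ hl1 f hf0 hfi a ha haf x hxQ
    choose! F hF0 hFeq hFle using hF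
    -- `F` is obtained by choice and is controlled only on `(0, 1]`. The modulus makes it
    -- nonnegative everywhere, and the Jensen substitute does not ask for measurability in `s`.
    set F₀ : ℝ → ℝ := fun s => |F s| / 2 with hF₀
    have hj : ENNReal.ofReal (v x / (2 * C)) ≤
        ∫⁻ s in Set.Ioc (0 : ℝ) 1, ENNReal.ofReal (F₀ s) := by
      have h1 : ∫⁻ s in Set.Ioc (0 : ℝ) 1,
          ∫⁻ y, ENNReal.ofReal (f (x + s • (y - x))) ∂averageMeasure Q =
          ENNReal.ofReal 2 * ∫⁻ s in Set.Ioc (0 : ℝ) 1, ENNReal.ofReal (F₀ s) := by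
        rw [← lintegral_const_mul' _ _ ENNReal.ofReal_ne_top]
        refine setLIntegral_congr_fun measurableSet_Ioc fun s hs => ?_
        have h2 : F s = 2 * F₀ s := by simp only [hF₀, abs_of_nonneg (hF0 s hs)]; ring
        change _ = ENNReal.ofReal 2 * ENNReal.ofReal (F₀ s)
        rw [hFeq s hs, ← ENNReal.ofReal_mul two_pos.le, ← h2]
      rw [h1, ← mul_assoc, ← ENNReal.ofReal_mul hC0.le] at hx
      calc ENNReal.ofReal (v x / (2 * C)) =
            ENNReal.ofReal ((C * 2)⁻¹) * ENNReal.ofReal (v x) := by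
            rw [← ENNReal.ofReal_mul (by positivity)]
            congr 1
            rw [mul_comm C 2]
            ring
        _ ≤ ENNReal.ofReal ((C * 2)⁻¹) * (ENNReal.ofReal (C * 2) *
              ∫⁻ s in Set.Ioc (0 : ℝ) 1, ENNReal.ofReal (F₀ s)) := by gcongr
        _ = _ := by
            rw [← mul_assoc, ← ENNReal.ofReal_mul (by positivity),
              inv_mul_cancel₀ (by positivity), ENNReal.ofReal_one, one_mul]
    have hvx := hv0 x
    have hjen := shiftPow_half_le_lintegral (a := a) (q := (p x).toReal) ha hp1
      (by positivity) (fun s => by positivity) hj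
    have hdil : shiftPow a (p x).toReal (v x) ≤
        T * shiftPow a (p x).toReal (v x / (2 * C) / 2) := by
      have h := shiftPow_mul_le (a := a) (q := (p x).toReal) (t := v x / (2 * C) / 2)
        (c := 4 * C) ha hp1 (by positivity) (by linarith)
      have h2 : 4 * C * (v x / (2 * C) / 2) = v x := by field_simp; ring
      rw [h2] at h
      refine h.trans (mul_le_mul_of_nonneg_right ?_ (shiftPow_nonneg ha (by positivity)))
      exact Real.rpow_le_rpow_of_exponent_le (by linarith) (by linarith)
    calc ENNReal.ofReal (shiftPow a (p x).toReal (v x)) ≤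
          ENNReal.ofReal T * ENNReal.ofReal (shiftPow a (p x).toReal (v x / (2 * C) / 2)) := by
          rw [← ENNReal.ofReal_mul hT0.le]; exact ENNReal.ofReal_le_ofReal hdil
      _ ≤ ENNReal.ofReal T * ∫⁻ s in Set.Ioc (0 : ℝ) 1,
            ENNReal.ofReal (shiftPow a (p x).toReal (F₀ s)) := by gcongr
      _ ≤ _ := by
          refine mul_le_mul_right (setLIntegral_mono' measurableSet_Ioc fun s hs => ?_) _
          simp only [hF₀]
          rw [abs_of_nonneg (hF0 s hs)]
          exact hFle s hs
  have hmeas : Measurable (fun z : EuclideanSpace ℝ (Fin n) × ℝ =>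
      ∫⁻ y, g (z.1 + z.2 • (y - z.1)) ∂averageMeasure Q) := by
    have : SFinite (averageMeasure Q) := by unfold averageMeasure; infer_instance
    exact Measurable.lintegral_prod_right'
      (f := fun q : (EuclideanSpace ℝ (Fin n) × ℝ) × EuclideanSpace ℝ (Fin n) =>
        g (q.1.1 + q.1.2 • (q.2 - q.1.1))) (hgm.comp (by fun_prop))
  have hdouble : ∫⁻ x in Q, ∫⁻ s in Set.Ioc (0 : ℝ) 1,
      ∫⁻ y, g (x + s • (y - x)) ∂averageMeasure Q ≤
      ENNReal.ofReal (2 ^ n) * ∫⁻ y in Q, g y := by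
    rw [lintegral_lintegral_swap hmeas.aemeasurable]
    calc _ ≤ ∫⁻ s in Set.Ioc (0 : ℝ) 1, ENNReal.ofReal (2 ^ n) * ∫⁻ y in Q, g y := by
          refine setLIntegral_mono' measurableSet_Ioc fun s hs => ?_
          simp_rw [lintegral_averageMeasure]
          rw [lintegral_const_mul' _ _ (ENNReal.inv_ne_top.2 hQv0)]
          calc _ ≤ (volume Q)⁻¹ * (ENNReal.ofReal (2 ^ n) * ((∫⁻ y in Q, g y) * volume Q)) := by
                gcongr
                exact setLIntegral_setLIntegral_homothety_le hQ.convex hQm hs.1 hs.2 hgm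
            _ = ((volume Q)⁻¹ * volume Q) * (ENNReal.ofReal (2 ^ n) * ∫⁻ y in Q, g y) := by ring
            _ = _ := by rw [ENNReal.inv_mul_cancel hQv0 hQvt, one_mul]
      _ = _ := by simp
  have hVm : 0 ≤ V ^ m := by positivity
  calc (∫⁻ x in Q, ENNReal.ofReal (shiftPow a (p x).toReal (v x)))
      ≤ ∫⁻ x in Q, ENNReal.ofReal T * ∫⁻ s in Set.Ioc (0 : ℝ) 1,
        (ENNReal.ofReal B * (∫⁻ y, g (x + s • (y - x)) ∂averageMeasure Q) +
          ENNReal.ofReal (E * V ^ m)) := lintegral_mono_ae hpt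
    _ = ENNReal.ofReal T * (ENNReal.ofReal B * (∫⁻ x in Q, ∫⁻ s in Set.Ioc (0 : ℝ) 1,
          ∫⁻ y, g (x + s • (y - x)) ∂averageMeasure Q) +
          ENNReal.ofReal (E * V ^ m) * volume Q) := by
        rw [lintegral_const_mul' _ _ ENNReal.ofReal_ne_top]
        congr 1
        rw [← setLIntegral_const, ← lintegral_const_mul' _ _ ENNReal.ofReal_ne_top,
          ← lintegral_add_right _ measurable_const]
        refine lintegral_congr fun x => ?_
        rw [lintegral_add_right _ measurable_const, lintegral_const_mul' _ _ ENNReal.ofReal_ne_top]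
        simp
    _ ≤ ENNReal.ofReal T * (ENNReal.ofReal B * (ENNReal.ofReal (2 ^ n) * ∫⁻ y in Q, g y) +
          ENNReal.ofReal (E * V ^ m) * ENNReal.ofReal (n ^ n * w)) := by gcongr
    _ = ENNReal.ofReal (T * (B * 2 ^ n)) * (∫⁻ y in Q, g y) +
          ENNReal.ofReal (T * (E * (n ^ n * w)) * V ^ m) := by
        rw [mul_add, ← ENNReal.ofReal_mul (by positivity), ← mul_assoc (ENNReal.ofReal B),
          ← ENNReal.ofReal_mul hB, ← mul_assoc, ← ENNReal.ofReal_mul hT0.le,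
          ← ENNReal.ofReal_mul hT0.le]
        congr 2
        ring
    _ ≤ _ := by
        have h1 : 0 ≤ T * (B * 2 ^ n) := by positivity
        have h2 : 0 ≤ T * (E * (n ^ n * w)) := by positivity
        gcongr
        · linarith
        · linarith

end ShiftedKorn

/-! ### The shifted Korn inequality -/

theorem mainTheorem8 (n : ℕ) (hn : 1 ≤ n) :
    ∃ 𝓡 : Set (EuclideanSpace ℝ (Fin n)) →
        (EuclideanSpace ℝ (Fin n) → EuclideanSpace ℝ (Fin n)) →
        (EuclideanSpace ℝ (Fin n) → EuclideanSpace ℝ (Fin n)),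
      (∀ Q u, IsRigidMotion (𝓡 Q u)) ∧
      ∀ (m : ℝ), 0 < m → ∀ (K P : ℝ≥0), ∃ c : ℝ, 0 < c ∧
        ∀ p : EuclideanSpace ℝ (Fin n) → ℝ≥0∞,
          IsLogHolderExponent p → cLog p ≤ (K : ℝ) → pPlus p ≤ (P : ℝ≥0∞) →
        ∀ (Q : Set (EuclideanSpace ℝ (Fin n))) (l : ℝ), IsCubeOrBall Q l → l ≤ 1 →
        ∀ (u : EuclideanSpace ℝ (Fin n) → EuclideanSpace ℝ (Fin n))
          (G : EuclideanSpace ℝ (Fin n) → Matrix (Fin n) (Fin n) ℝ),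
          MemVarSobolev p Q u G →
        ∀ a : ℝ, 0 ≤ a →
          a + (⨍ x in Q, matNorm (symPart (G x))) ≤ (volume.real Q) ^ (-m) →
          (∫⁻ x in Q, ENNReal.ofReal (phiShift p a x (‖u x - 𝓡 Q u x‖ / l))) ≤
            ENNReal.ofReal c *
                (∫⁻ x in Q, ENNReal.ofReal (phiShift p a x (matNorm (symPart (G x))))) +
              ENNReal.ofReal (c * (volume.real Q) ^ m) := by
  classical
  obtain ⟨C, hC, hrep⟩ := exists_rigidMotion_pointwise hn
  choose R hR hRest using hrep
  -- The zero motion is a default outside the range of the construction. A field in the Sobolev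
  -- space of the theorem always falls in the first case, being integrable on `Q`.
  refine ⟨fun Q u => if h : (∃ l, IsCubeOrBall Q l) ∧ ∀ i, IntegrableOn (fun y => u y i) Q then
    R Q h.1 u h.2 else 0, fun Q u => ?_, fun m hm K P => ?_⟩
  · beta_reduce
    split_ifs with h
    · exact hR _ _ _ _
    · exact ⟨0, 0, by simp, fun x => by simp⟩
  obtain ⟨c, hc, hmod⟩ := exists_modular_estimate hn hC hm K P
  have hP0 : (0 : ℝ) ≤ P := P.2
  refine ⟨(P + 1) * (c * 2 ^ ((P : ℝ) + 1) + c), by positivity, ?_⟩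
  intro p hp hK hP Q l hQ hl1 u G hu a ha haf
  have hl := hQ.1
  have hQvt := hQ.volume_ne_top hn
  have hQm := hQ.isOpen.measurableSet
  have hp1 : ∀ x, 1 ≤ (p x).toReal := fun x => (exponent_bounds hp hP x).2.1
  have hpP : ∀ x, (p x).toReal ≤ P := fun x => (exponent_bounds hp hP x).2.2
  have hui : ∀ i, IntegrableOn (fun y => u y i) Q := fun i => (hu i).1.integrableOn hp1 hQvt
  have hGi : ∀ i j, IntegrableOn (fun y => G y i j) Q := fun i j =>
    ((hu i).2 j).2.integrableOn hp1 hQvt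
  beta_reduce
  rw [dif_pos ⟨⟨l, hQ⟩, hui⟩]
  set Ru := R Q ⟨l, hQ⟩ u hui with hRu
  have hSi : ∀ i j, IntegrableOn (fun y => symPart (G y) i j) Q := fun i j => by
    have h : (fun y => symPart (G y) i j) = fun y => (1 / 2 : ℝ) * (G y i j + G y j i) := by
      ext y
      simp [symPart]
    rw [h]
    exact ((hGi i j).add (hGi j i)).const_mul _
  have hNm : AEMeasurable (fun y => matNorm (symPart (G y))) (volume.restrict Q) := by
    unfold matNorm
    refine Real.continuous_sqrt.measurable.comp_aemeasurable ?_
    exact Finset.aemeasurable_fun_sum _ fun i _ => Finset.aemeasurable_fun_sum _ fun j _ =>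
      (hSi i j).aemeasurable.pow_const 2
  have hNi : IntegrableOn (fun y => matNorm (symPart (G y))) Q := by
    refine Integrable.mono' (g := fun y => ∑ i, ∑ j, |symPart (G y) i j|)
      (integrable_finsetSum _ fun i _ => integrable_finsetSum _ fun j _ => (hSi i j).norm) hNm.aestronglyMeasurable (Filter.Eventually.of_forall fun y => ?_)
    rw [Real.norm_of_nonneg (matNorm_nonneg _)]
    exact matNorm_le_sum _
  -- `Du` is only almost everywhere measurable on `Q`, whereas the Fubini argument composes with
  -- homotheties and needs a Borel function; the modulus makes the representative nonnegative
  -- everywhere.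
  set f : EuclideanSpace ℝ (Fin n) → ℝ := fun y => |hNm.mk _ y| with hf
  have hfm : Measurable f := hNm.measurable_mk.abs
  have hf0 : ∀ y, 0 ≤ f y := fun y => abs_nonneg _
  have hfe : ∀ᵐ y ∂(volume.restrict Q), matNorm (symPart (G y)) = f y := by
    filter_upwards [hNm.ae_eq_mk] with y hy
    rw [hf]
    simp only [← hy, abs_of_nonneg (matNorm_nonneg (symPart (G y)))]
  have hfi : IntegrableOn f Q := hNi.congr hfe
  have haf' : a + (⨍ y in Q, f y) ≤ (volume.real Q) ^ (-m) := by
    rwa [← average_congr hfe]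
  have hpt := hRest Q ⟨l, hQ⟩ u hui l hQ G f hGi (fun i j => ((hu i).2 j).1) hf0
    (hfe.mono fun y hy => hy.le)
  have hfin := hmod p hp hK hP Q l hQ hl1 f hfm hf0 hfi a ha haf' (fun x => ‖u x - Ru x‖ / l)
    (fun x => by positivity) ?_
  · have hPP : (0 : ℝ) ≤ P + 1 := by positivity
    calc _ ≤ ∫⁻ x in Q, ENNReal.ofReal (P + 1) *
            ENNReal.ofReal (shiftPow a (p x).toReal (‖u x - Ru x‖ / l)) := by
          refine lintegral_mono fun x => ?_
          rw [← ENNReal.ofReal_mul hPP]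
          exact ENNReal.ofReal_le_ofReal
            (phiShift_le ha (by positivity) (hp1 x) ((hpP x).trans (by linarith)))
      _ = ENNReal.ofReal (P + 1) *
            ∫⁻ x in Q, ENNReal.ofReal (shiftPow a (p x).toReal (‖u x - Ru x‖ / l)) :=
          lintegral_const_mul' _ _ ENNReal.ofReal_ne_top
      _ ≤ ENNReal.ofReal (P + 1) * (ENNReal.ofReal c *
            (ENNReal.ofReal (2 ^ ((P : ℝ) + 1)) *
              ∫⁻ x in Q, ENNReal.ofReal (phiShift p a x (matNorm (symPart (G x))))) +
            ENNReal.ofReal (c * (volume.real Q) ^ m)) := by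
          refine mul_le_mul_right (hfin.trans ?_) _
          gcongr
          rw [← lintegral_const_mul' _ _ ENNReal.ofReal_ne_top]
          refine lintegral_mono_ae ?_
          filter_upwards [hfe] with x hx
          rw [← ENNReal.ofReal_mul (by positivity), hx]
          exact ENNReal.ofReal_le_ofReal (le_phiShift ha (hf0 x) (hp1 x) (hpP x))
      _ = ENNReal.ofReal ((P + 1) * (c * 2 ^ ((P : ℝ) + 1))) *
            (∫⁻ x in Q, ENNReal.ofReal (phiShift p a x (matNorm (symPart (G x))))) +
            ENNReal.ofReal ((P + 1) * c * (volume.real Q) ^ m) := by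
          rw [mul_add, ← mul_assoc (ENNReal.ofReal c), ← ENNReal.ofReal_mul hc.le, ← mul_assoc,
            ← ENNReal.ofReal_mul hPP, ← ENNReal.ofReal_mul hPP, mul_assoc _ c]
      _ ≤ _ := by
          have h1 : 0 ≤ c * 2 ^ ((P : ℝ) + 1) := by positivity
          gcongr <;> linarith
  · filter_upwards [hpt] with x hx
    have h1 : ENNReal.ofReal (‖u x - Ru x‖ / l) = ENNReal.ofReal l⁻¹ * ‖u x - Ru x‖ₑ := by
      rw [← ofReal_norm, ← ENNReal.ofReal_mul (by positivity)]
      congr 1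
      ring
    rw [h1]
    calc _ ≤ ENNReal.ofReal l⁻¹ * (ENNReal.ofReal (C * l) * ∫⁻ s in Set.Ioc (0 : ℝ) 1,
          ∫⁻ y, ENNReal.ofReal (f (x + s • (y - x))) ∂averageMeasure Q) := by gcongr
      _ = _ := by
          rw [← mul_assoc, ← ENNReal.ofReal_mul (by positivity)]
          congr 2
          field_simp
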